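/- **Theorem 4.** *Setting.* Let $G=(V,E)$ be a finite graph with $N=|V|$ nodes, $K$-partite ($K\ge 2$) with nonempty components $V_1,\dots,V_K$ (nodes in the same component are not adjacent), such that every node belongs to a clique of size $K$. Put $M_k=|V_k|$, $M=\max_k M_k$. Let $\Omega\subseteq\{0,1\}^V$ be the set of incidence vectors of independent sets of $G$, $v^{(k)}\in\Omega$ the incidence vector of $V_k$, $\Omega^*=\{v^{(1)},\dots,v^{(K)}\}$, and $H(u)=\sum_{k=1}^K\sum_{i\in V_k}u_i/M_k$. Assume (Assumption 1) that $H(u)\le 1$ for all $u\in\Omega$, with strict inequality for $u\notin\Omega^*$, and put $\zeta=1-\max_{u\in\Omega\setminus\Omega^*}H(u)>0$. Consider the random-access network on $G$ with Poisson arrivals of rate $\lambda_i=\hat\rho_k>0$ at each node $i\in V_k$, exponential unit-mean transmission times, and fixed back-off rates $\nu_i>0$. That is, let $(U(t),X(t))$ be the Markov process on $\Omega\times\mathbb N_0^V$ with the transitions $(u,x)\to(u,x+e_i)$ at rate $\lambda_i$; $(u,x)\to(u+e_i,x)$ at rate $\nu_i$ if $i$ and all its neighbours are inactive in $u$; and $(u,x)\to(u-e_i,\,x-e_i\mathbf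 1\{x_i>0\})$ at rate $1$ if $u_i=1$. The system is called stable if this process is positive recurrent; $\mathbb E[X_i]\in[0,\infty]$ denotes the mean of $X_i$ under the stationary distribution. Let $\rho=\sum_{k}\hat\rho_k$ and $\rho_{\min}=\min_k\hat\rho_k$. *Coefficients.* Let $w\in\mathbb R_+^V$ and $S\subseteq V_k$ for some $k$, with $w_i>0$ for at least one $i\in S$. Put $$\Delta(S)=\Big\{u\in\Omega:\sum_{i\in S}w_i\lambda_i\le\sum_{i\in S}w_iu_i\Big\},\qquad \delta(S)=\sum_{i\in S}w_i\lambda_i-\max_{u\in\Omega\setminus\Delta(S)}\sum_{i\in S}w_iu_i .$$ A path is a finite sequence of states of $\Omega$ in which consecutive states differ by the activation or de-activation of a single node. For $u\ne v$ in $\Omega$ let $M(u,v)$ be the maximum, over all paths from $u$ to $v$, of the minimum of $H$ along the path (both endpoints included), and let $M(u,u)=\infty$. For $l\ne k$ let $m_l(S)=\max_{u\in\Delta(S)}M(v^{(l)},u)$ and $S_l(S)=\{u\in\Omega:M(v^{(l)},u)>m_l(S)\}$; let $m_k(S)=\max_{l\ne k}m_l(S)$ and $S_k(S)=\{v\in\Omega:\max_{u\in\Delta(S)}M(u,v)>m_k(S)\}$.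 For $B\subseteq\Omega$ let $\partial B$ be the set of states of $B$ from which some state outside $B$ can be reached in one activation or de-activation. For $l=1,\dots,K$ let $H_l(S)=\max_{u\in\partial S_l(S)}H(u)$, and let $H^*(S)=\min_{l=1,\dots,K}H_l(S)$. *Claim.* Let $\gamma>0$ and assume $\rho\ge 1-\gamma\,\zeta\,\rho_{\min}^2$. Then for any activation rate vector $(\nu_i)_{i\in V}$ such that $\nu_i=\nu_j$ whenever $i$ and $j$ are in the same component and such that the system is stable, and for any $w$ and $S\subseteq V_k$ as above, $$\sum_{i\in S}w_i\,\mathbb E[X_i]>\frac{\delta(S)\,(1-4\gamma)\,\rho_{\min}^{M+3}}{2^{N+1}}\Big(\frac1{1-\rho}\Big)^{M(1-H^*(S))}.$$ -/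

import Mathlib

open scoped ENNReal

namespace RandomAccess

noncomputable section

/-! ### Activity states and the queueing process -/

/-- Feasible joint activity states of the network: the independent sets of the interference
graph. A state is recorded as the set of its active nodes. -/
abbrev ActState {V : Type*} (G : SimpleGraph V) : Type _ :=
  {u : Finset V // G.IsIndepSet (u : Set V)}

/-- States `(U, X)` of the full process: the activity state and the numbers of packets. -/
abbrev NetState {V : Type*} (G : SimpleGraph V) : Type _ := ActState G × (V → ℕ)

open Classical in
/-- Transition rate from `s` to `s'` of the process `(U(t), X(t))` under fixed-rate random access
with unit service rates, in which a node releases the medium after every transmission.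
Node `i` has arrival rate `lam i` and back-off rate `nu i`. An active node with an empty buffer
transmits dummy packets, hence the truncated subtraction in the last line. -/
def rate {V : Type*} [Fintype V] (G : SimpleGraph V) (lam nu : V → ℝ)
    (s s' : NetState G) : ℝ≥0∞ :=
  ∑ i : V,
    ((if s'.1 = s.1 ∧ s'.2 = s.2 + Pi.single i 1 then ENNReal.ofReal (lam i) else 0)
    + (if i ∉ s.1.1 ∧ (∀ j, G.Adj i j → j ∉ s.1.1) ∧ s'.1.1 = insert i s.1.1 ∧ s'.2 = s.2
        then ENNReal.ofReal (nu i) else 0)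
    + (if i ∈ s.1.1 ∧ s'.1.1 = s.1.1.erase i ∧ s'.2 = s.2 - Pi.single i 1 then 1 else 0))

/-- Total transition rate out of a state (the process has no transitions from a state to
itself). -/
def exitRate {V : Type*} [Fintype V] (G : SimpleGraph V) (lam nu : V → ℝ)
    (s : NetState G) : ℝ≥0∞ :=
  ∑' s', rate G lam nu s s'

open Classical in
/-- `tabooProb G lam nu s n y` is the probability that the embedded jump chain started in `s`
is in `y` after `n` jumps and has not returned to `s` in any of the jumps `1, …, n`. -/
def tabooProb {V : Type*} [Fintype V] (G : SimpleGraph V) (lam nu : V → ℝ) (s : NetState G) :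
    ℕ → NetState G → ℝ≥0∞
  | 0, y => if y = s then 1 else 0
  | n + 1, y =>
      if y = s then 0
      else ∑' z, tabooProb G lam nu s n z * (rate G lam nu z y / exitRate G lam nu z)

/-- Expected return time to `s`: the holding time in each state visited before the return to
`s` has mean `1 / exitRate`. -/
def meanReturnTime {V : Type*} [Fintype V] (G : SimpleGraph V) (lam nu : V → ℝ)
    (s : NetState G) : ℝ≥0∞ :=
  ∑' n, ∑' y, tabooProb G lam nu s n y * (exitRate G lam nu y)⁻¹

/-- Stability: the process `(U(t), X(t))` is positive recurrent. -/
def Stable {V : Type*} [Fintype V] (G : SimpleGraph V) (lam nu : V → ℝ) : Prop :=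
  ∀ s, meanReturnTime G lam nu s < ∞

/-- `p` is a stationary distribution of the process `(U(t), X(t))`. The transition rates out of
the states are bounded, so that stationarity is the system of global balance equations. -/
def IsStationary {V : Type*} [Fintype V] (G : SimpleGraph V) (lam nu : V → ℝ)
    (p : PMF (NetState G)) : Prop :=
  ∀ s, p s * exitRate G lam nu s = ∑' s', p s' * rate G lam nu s' s

/-- Expected number of packets at node `i` under `p` (possibly infinite). -/
def meanQueue {V : Type*} {G : SimpleGraph V} (p : PMF (NetState G)) (i : V) : ℝ≥0∞ :=
  ∑' s, p s * (s.2 i : ℝ≥0∞)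

/-! ### Partite graphs -/

section Partite

variable {V : Type*} [Fintype V] {G : SimpleGraph V} {K : ℕ}

open Classical in
/-- The `k`-th component `V_k`. -/
def comp (C : G.Coloring (Fin K)) (k : Fin K) : Finset V := Finset.univ.filter (fun i => C i = k)

/-- The component size `M_k`. -/
def compSize (C : G.Coloring (Fin K)) (k : Fin K) : ℕ := (comp C k).card

/-- The maximum component size `M`. -/
def maxSize (C : G.Coloring (Fin K)) : ℕ := Finset.univ.sup (compSize C)

/-- The state `v^(k)` in which exactly the nodes of `V_k` are active. -/
def fullState (C : G.Coloring (Fin K)) (k : Fin K) : ActState G :=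
  ⟨comp C k, by
    intro i hi j hj _ hadj
    simp only [comp, Finset.coe_filter, Finset.mem_univ, true_and, Set.mem_ofPred_eq] at hi hj
    exact C.valid hadj (hi.trans hj.symm)⟩

/-- The set `Ω*` of the states `v^(1), …, v^(K)`. -/
def fullStates (C : G.Coloring (Fin K)) : Set (ActState G) := Set.range (fullState C)

open Classical in
/-- `H(u) = ∑_k ∑_{i ∈ V_k} u_i / M_k`. -/
def H (C : G.Coloring (Fin K)) (u : ActState G) : ℝ :=
  ∑ k : Fin K, ∑ i ∈ comp C k, (if i ∈ u.1 then (1 : ℝ) else 0) / (compSize C k : ℝ)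

/-- Joint activity across components is inefficient: `H ≤ 1`, strictly outside `Ω*`. -/
def JointActivityInefficient (C : G.Coloring (Fin K)) : Prop :=
  ∀ u : ActState G, H C u ≤ 1 ∧ (u ∉ fullStates C → H C u < 1)

/-- `ζ = 1 - max_{u ∈ Ω \ Ω*} H(u)`. -/
def zeta (C : G.Coloring (Fin K)) : ℝ := 1 - sSup (H C '' (fullStates C)ᶜ)

open Classical in
/-- Feasible transitions of the activity process: a single node is activated or de-activated. -/
def Step (u u' : ActState G) : Prop :=
  (∃ i, i ∉ u.1 ∧ u'.1 = insert i u.1) ∨ (∃ i, i ∈ u.1 ∧ u'.1 = u.1.erase i)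

/-- `(p 0, …, p n)` is a path from `u` to `v`. -/
def IsPath {n : ℕ} (p : Fin (n + 1) → ActState G) (u v : ActState G) : Prop :=
  p 0 = u ∧ p (Fin.last n) = v ∧ ∀ k : Fin n, Step (p k.castSucc) (p k.succ)

/-- The minimum `m(p)` of `H` along the path `p`. -/
def pathMin (C : G.Coloring (Fin K)) {n : ℕ} (p : Fin (n + 1) → ActState G) : EReal :=
  ⨅ k, (H C (p k) : EReal)

open Classical in
/-- `M(u, v)`: the maximum of `m(p)` over all paths `p` from `u` to `v`, and `M(u, u) = ∞`. -/
def pathMaxMin (C : G.Coloring (Fin K)) (u v : ActState G) : EReal :=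
  if u = v then ⊤
  else ⨆ (n : ℕ) (p : Fin (n + 1) → ActState G) (_ : IsPath p u v), pathMin C p

/-! ### The sets and coefficients belonging to a set `S ⊆ V_k` of nodes -/

open Classical in
/-- `∑_{i ∈ S} w_i u_i`: the weighted service rate of `S` in state `u` (unit service rates). -/
def serviceRate (w : V → ℝ) (S : Finset V) (u : ActState G) : ℝ :=
  ∑ i ∈ S, w i * (if i ∈ u.1 then 1 else 0)

/-- `∑_{i ∈ S} w_i λ_i`: the weighted arrival rate of `S`. -/
def arrivalRate (lam w : V → ℝ) (S : Finset V) : ℝ := ∑ i ∈ S, w i * lam i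

/-- `Δ(S)`: the states in which the weighted drift of `S` is non-positive. -/
def Delta (G : SimpleGraph V) (lam w : V → ℝ) (S : Finset V) : Set (ActState G) :=
  {u | arrivalRate lam w S ≤ serviceRate w S u}

/-- `δ(S)`: the minimal weighted drift of `S` outside `Δ(S)`. -/
def drift (G : SimpleGraph V) (lam w : V → ℝ) (S : Finset V) : ℝ :=
  arrivalRate lam w S - sSup (serviceRate w S '' (Delta G lam w S)ᶜ)

/-- `m_l(S)` for `l ≠ k`. -/
def levelOther (C : G.Coloring (Fin K)) (lam w : V → ℝ) (S : Finset V) (l : Fin K) : EReal :=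
  ⨆ u ∈ Delta G lam w S, pathMaxMin C (fullState C l) u

/-- `m_k(S) = max_{l ≠ k} m_l(S)`. -/
def levelOwn (C : G.Coloring (Fin K)) (lam w : V → ℝ) (S : Finset V) (k : Fin K) : EReal :=
  ⨆ (l : Fin K) (_ : l ≠ k), levelOther C lam w S l

/-- The sets `S_l(S)`, `l = 1, …, K`, of activity states, where `S ⊆ V_k`. -/
def bottleneckSet (C : G.Coloring (Fin K)) (lam w : V → ℝ) (S : Finset V) (k l : Fin K) :
    Set (ActState G) :=
  if l = k then
    {v | levelOwn C lam w S k < ⨆ u ∈ Delta G lam w S, pathMaxMin C u v}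
  else
    {u | levelOther C lam w S l < pathMaxMin C (fullState C l) u}

/-- The boundary: the states of `B` from which `B` can be left in one transition. -/
def boundary (B : Set (ActState G)) : Set (ActState G) :=
  {u | u ∈ B ∧ ∃ u', u' ∉ B ∧ Step u u'}

/-- `H_l(S) = max_{u ∈ ∂S_l(S)} H(u)`. -/
def Hcoef (C : G.Coloring (Fin K)) (lam w : V → ℝ) (S : Finset V) (k l : Fin K) : ℝ :=
  sSup (H C '' boundary (bottleneckSet C lam w S k l))

/-- `H*(S) = min_l H_l(S)`. -/
def Hstar (C : G.Coloring (Fin K)) (lam w : V → ℝ) (S : Finset V) (k : Fin K) : ℝ :=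
  ⨅ l, Hcoef C lam w S k l

end Partite

end

end RandomAccess

/-! The mean backlog of `S` is large because the activity process is slow to leave some set of
states in which `S` gets almost no service.

Law of the activity state. The activity marginal is reversible with product-form weights. Rate
conservation at a node gives that each node is active with probability at least its arrival rate.
Averaging `H` then bounds the mass outside `Ω*` by `(1 - ρ) / ζ ≤ γ ρ_min ^ 2`, so each full state
carries nearly its load. A node can be activated only when a clique of size `K` through it is
silent, which has probability at most `1 - ρ`; detailed balance therefore forces `ν_i ≥ λ_i / (1 -
ρ)`. With back-off rates equal within components, this yields `π(u) ≤ r ^ (M (1 - H(u)))` for `r =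
(1 - ρ) / ρ_min` (`IsStationary.marginal_le_rpow`).

Trap. The sets `S_l(S)` are closed under activation, so their boundary is crossed only by
de-activations out of states with `H ≤ H_l(S)`, and the flow is of order `r ^ (M (1 - H_l(S)))`
(`outflow_bottleneckSet_le`). The set, or its complement when `l = k`, is a trap `A` of
non-negligible mass which transmissions of `S` enter only from outside `Ω*` (`exists_trap`).

Backlog. Let `f(u)` be the expected time spent in `A` before leaving it, discounted at rate `α`, and
`Y` the weighted backlog. The stationary drift of `f(U) Y(X)` vanishes when `E[Y]` is finite; since
`gen f ≥ -1`, this bounds `E[Y]` below by the arrival rate times `E[f]` minus a term from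
transmissions of `S` ending in `A` (`IsStationary.le_backlog`). Small flow makes `E[f]` at least
`π(A) / (2 α)`, and `α` is taken proportional to the flow bound divided by `π(A)`. -/

namespace RandomAccess

noncomputable section

open scoped Classical

/-! ### Activation and de-activation -/

section Moves

variable {V : Type*} {G : SimpleGraph V}

/-- Node `i` may be activated in state `u`. -/
def CanAct (u : ActState G) (i : V) : Prop := i ∉ u.1 ∧ ∀ j, G.Adj i j → j ∉ u.1

/-- The state after activation of `i`; the same state if `i` cannot be activated. -/
def add (u : ActState G) (i : V) : ActState G :=
  if h : CanAct u i then ⟨insert i u.1, by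
    have hu := u.2
    rw [Finset.coe_insert, SimpleGraph.isIndepSet_iff]
    intro a ha b hb hab hadj
    rcases ha with rfl | ha <;> rcases hb with rfl | hb
    · exact hab rfl
    · exact h.2 _ hadj hb
    · exact h.2 _ hadj.symm ha
    · exact hu ha hb hab hadj⟩ else u

/-- The state after de-activation of `i`. -/
def del (u : ActState G) (i : V) : ActState G :=
  ⟨u.1.erase i, fun _ ha _ hb hab =>
    u.2 (Finset.mem_of_mem_erase ha) (Finset.mem_of_mem_erase hb) hab⟩

lemma add_val {u : ActState G} {i : V} (h : CanAct u i) : (add u i).1 = insert i u.1 := by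
  simp [add, h]

lemma del_val (u : ActState G) (i : V) : (del u i).1 = u.1.erase i := rfl

lemma mem_add {u : ActState G} {i : V} (h : CanAct u i) : i ∈ (add u i).1 := by
  simp [add_val h]

lemma del_add {u : ActState G} {i : V} (h : CanAct u i) : del (add u i) i = u := by
  apply Subtype.ext
  rw [del_val, add_val h, Finset.erase_insert h.1]

lemma canAct_del {u : ActState G} {i : V} (h : i ∈ u.1) : CanAct (del u i) i := by
  refine ⟨by simp [del_val], fun j hij hj => ?_⟩
  exact u.2 h (Finset.mem_of_mem_erase hj) hij.ne hij

lemma add_del {u : ActState G} {i : V} (h : i ∈ u.1) : add (del u i) i = u := by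
  apply Subtype.ext
  rw [add_val (canAct_del h), del_val, Finset.insert_erase h]

lemma step_add {u : ActState G} {i : V} (h : CanAct u i) : Step u (add u i) :=
  Or.inl ⟨i, h.1, add_val h⟩

lemma step_del {u : ActState G} {i : V} (h : i ∈ u.1) : Step u (del u i) :=
  Or.inr ⟨i, h, rfl⟩

/-- The state without active nodes. -/
def idle : ActState G := ⟨∅, by simp [SimpleGraph.isIndepSet_iff]⟩

lemma eq_idle_of_forall {u : ActState G} (h : ∀ i, i ∉ u.1) : u = idle :=
  Subtype.ext (Finset.eq_empty_of_forall_notMem h)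

/-- The expectation of the positive part of `F` under `p`. -/
def expect (p : PMF (NetState G)) (F : NetState G → ℝ) : ℝ≥0∞ :=
  ∑' s, p s * ENNReal.ofReal (F s)

lemma expect_add (p : PMF (NetState G)) {F F' : NetState G → ℝ} (hF : ∀ s, 0 ≤ F s)
    (hF' : ∀ s, 0 ≤ F' s) : expect p (fun s => F s + F' s) = expect p F + expect p F' := by
  unfold expect
  rw [← ENNReal.tsum_add]
  exact tsum_congr fun s => by rw [ENNReal.ofReal_add (hF s) (hF' s), mul_add]

lemma expect_mono (p : PMF (NetState G)) {F F' : NetState G → ℝ} (h : ∀ s, F s ≤ F' s) :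
    expect p F ≤ expect p F' :=
  ENNReal.tsum_le_tsum fun s => mul_le_mul_right (ENNReal.ofReal_le_ofReal (h s)) _

end Moves

/-! ### Global balance -/

section Balance

variable {V : Type*} [Fintype V] {G : SimpleGraph V}

/-- The total rate of departure from a state with activity state `u`. -/
def totalRate (lam nu : V → ℝ) (u : ActState G) : ℝ :=
  ∑ i, (lam i + (if CanAct u i then nu i else 0) + (if i ∈ u.1 then 1 else 0))

/-- The rate-weighted sum of `F` over the states that can be reached in one transition. -/
def rateSum (lam nu : V → ℝ) (F : NetState G → ℝ) (s : NetState G) : ℝ :=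
  ∑ i, (lam i * F (s.1, s.2 + Pi.single i 1)
    + (if CanAct s.1 i then nu i * F (add s.1 i, s.2) else 0)
    + (if i ∈ s.1.1 then F (del s.1 i, s.2 - Pi.single i 1) else 0))

lemma tsum_rate_mul {lam nu : V → ℝ} (hlam : ∀ i, 0 ≤ lam i) (hnu : ∀ i, 0 ≤ nu i)
    {F : NetState G → ℝ} (hF : ∀ s, 0 ≤ F s) (s : NetState G) :
    ∑' s', rate G lam nu s s' * ENNReal.ofReal (F s')
      = ENNReal.ofReal (rateSum lam nu F s) := by
  have single : ∀ (t : NetState G) (P : NetState G → Prop) [DecidablePred P] (c : ℝ≥0∞),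
      (∀ s', P s' ↔ s' = t) →
      ∑' s', (if P s' then c else 0) * ENNReal.ofReal (F s') = c * ENNReal.ofReal (F t) := by
    intro t P _ c h
    rw [tsum_eq_single t]
    · simp [(h t).2 rfl]
    · intro b hb
      rw [if_neg (fun hP => hb ((h b).1 hP)), zero_mul]
  have none : ∀ (P : NetState G → Prop) [DecidablePred P] (c : ℝ≥0∞), (∀ s', ¬ P s') →
      ∑' s', (if P s' then c else 0) * ENNReal.ofReal (F s') = 0 := by
    intro P _ c h
    simp [h]
  simp only [rate, Finset.sum_mul, add_mul]
  rw [Summable.tsum_finsetSum (fun _ _ => ENNReal.summable), rateSum,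
    ENNReal.ofReal_sum_of_nonneg]
  · refine Finset.sum_congr rfl fun i _ => ?_
    rw [ENNReal.tsum_add, ENNReal.tsum_add, ENNReal.ofReal_add, ENNReal.ofReal_add]
    · congr 1
      · congr 1
        · rw [single (s.1, s.2 + Pi.single i 1), ENNReal.ofReal_mul (hlam i)]
          intro s'
          rw [Prod.ext_iff]
        · by_cases h : CanAct s.1 i
          · rw [single (add s.1 i, s.2), if_pos h, ENNReal.ofReal_mul (hnu i)]
            intro s'
            rw [Prod.ext_iff, Subtype.ext_iff, add_val h]
            exact ⟨fun hs => hs.2.2, fun hs => ⟨h.1, h.2, hs⟩⟩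
          · rw [none, if_neg h, ENNReal.ofReal_zero]
            exact fun s' hs => h ⟨hs.1, hs.2.1⟩
      · by_cases h : i ∈ s.1.1
        · rw [single (del s.1 i, s.2 - Pi.single i 1), if_pos h, one_mul]
          intro s'
          rw [Prod.ext_iff, Subtype.ext_iff, del_val]
          exact ⟨fun hs => hs.2, fun hs => ⟨h, hs⟩⟩
        · rw [none, if_neg h, ENNReal.ofReal_zero]
          exact fun s' hs => h hs.1
    · exact mul_nonneg (hlam i) (hF _)
    · split_ifs
      · exact mul_nonneg (hnu i) (hF _)
      · exact le_rfl
    · refine add_nonneg (mul_nonneg (hlam i) (hF _)) ?_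
      split_ifs
      · exact mul_nonneg (hnu i) (hF _)
      · exact le_rfl
    · split_ifs
      · exact hF _
      · exact le_rfl
  · intro i _
    refine add_nonneg (add_nonneg (mul_nonneg (hlam i) (hF _)) ?_) ?_
    · split_ifs
      · exact mul_nonneg (hnu i) (hF _)
      · exact le_rfl
    · split_ifs
      · exact hF _
      · exact le_rfl

lemma exitRate_eq {lam nu : V → ℝ} (hlam : ∀ i, 0 ≤ lam i) (hnu : ∀ i, 0 ≤ nu i)
    (s : NetState G) : exitRate G lam nu s = ENNReal.ofReal (totalRate lam nu s.1) := by
  have h := tsum_rate_mul hlam hnu (F := fun _ => 1) (fun _ => zero_le_one) s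
  simpa [exitRate, rateSum, totalRate] using h

lemma totalRate_nonneg {lam nu : V → ℝ} (hlam : ∀ i, 0 ≤ lam i) (hnu : ∀ i, 0 ≤ nu i)
    (u : ActState G) : 0 ≤ totalRate lam nu u := by
  refine Finset.sum_nonneg fun i _ => add_nonneg (add_nonneg (hlam i) ?_) ?_
  · split_ifs
    · exact hnu i
    · exact le_rfl
  · split_ifs <;> norm_num

/-- The balance equations integrated against `F`. All terms are nonnegative, so the exchange of sums
needs no integrability. -/
lemma IsStationary.expect_eq {lam nu : V → ℝ} {p : PMF (NetState G)}
    (hp : IsStationary G lam nu p) (hlam : ∀ i, 0 ≤ lam i) (hnu : ∀ i, 0 ≤ nu i)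
    {F : NetState G → ℝ} (hF : ∀ s, 0 ≤ F s) :
    expect p (fun s => totalRate lam nu s.1 * F s) = expect p (rateSum lam nu F) := by
  unfold expect
  calc ∑' s, p s * ENNReal.ofReal (totalRate lam nu s.1 * F s)
      = ∑' s, (∑' s', p s' * rate G lam nu s' s) * ENNReal.ofReal (F s) := by
        refine tsum_congr fun s => ?_
        rw [← hp s, exitRate_eq hlam hnu, ENNReal.ofReal_mul (totalRate_nonneg hlam hnu _),
          mul_assoc]
    _ = ∑' s, ∑' s', p s' * (rate G lam nu s' s * ENNReal.ofReal (F s)) := by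
        refine tsum_congr fun s => ?_
        rw [← ENNReal.tsum_mul_right]
        exact tsum_congr fun s' => mul_assoc _ _ _
    _ = ∑' s', p s' * ENNReal.ofReal (rateSum lam nu F s') := by
        rw [ENNReal.tsum_comm]
        refine tsum_congr fun s' => ?_
        rw [ENNReal.tsum_mul_left, tsum_rate_mul hlam hnu hF]

lemma rateSum_nonneg {lam nu : V → ℝ} (hlam : ∀ i, 0 ≤ lam i) (hnu : ∀ i, 0 ≤ nu i)
    {F : NetState G → ℝ} (hF : ∀ s, 0 ≤ F s) (s : NetState G) : 0 ≤ rateSum lam nu F s := by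
  refine Finset.sum_nonneg fun i _ => add_nonneg (add_nonneg (mul_nonneg (hlam i) (hF _)) ?_) ?_
  · split_ifs
    · exact mul_nonneg (hnu i) (hF _)
    · exact le_rfl
  · split_ifs
    · exact hF _
    · exact le_rfl

/-- Comparison of expectations by means of the stationary drift of a test function. -/
lemma IsStationary.expect_le {lam nu : V → ℝ} {p : PMF (NetState G)}
    (hp : IsStationary G lam nu p) (hlam : ∀ i, 0 ≤ lam i) (hnu : ∀ i, 0 ≤ nu i)
    {F Φ Ψ : NetState G → ℝ} (hF : ∀ s, 0 ≤ F s) (hΦ : ∀ s, 0 ≤ Φ s) (hΨ : ∀ s, 0 ≤ Ψ s)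
    (hfin : expect p F ≠ ∞)
    (h : ∀ s, totalRate lam nu s.1 * F s + Φ s ≤ rateSum lam nu F s + Ψ s) :
    expect p Φ ≤ expect p Ψ := by
  have hle := expect_mono p h
  rw [expect_add p (fun s => mul_nonneg (totalRate_nonneg hlam hnu _) (hF s)) hΦ,
    expect_add p (rateSum_nonneg hlam hnu hF) hΨ, ← hp.expect_eq hlam hnu hF] at hle
  refine (ENNReal.add_le_add_iff_left ?_).1 hle
  -- The common term can be cancelled because it is finite: the departure rate takes finitely many
  -- values.
  obtain ⟨c, hc⟩ := (Set.finite_range (totalRate lam nu (G := G))).bddAbove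
  refine ne_top_of_le_ne_top (ENNReal.mul_ne_top (ENNReal.ofReal_ne_top (r := c)) hfin) ?_
  unfold expect
  rw [← ENNReal.tsum_mul_left]
  refine ENNReal.tsum_le_tsum fun s => ?_
  rw [ENNReal.ofReal_mul (totalRate_nonneg hlam hnu _), mul_left_comm]
  gcongr
  exact hc ⟨s.1, rfl⟩

end Balance

/-! ### The activity process -/

section Weights

variable {V : Type*} {G : SimpleGraph V}

/-- Detailed balance for the activity process. -/
def Reversible (nu : V → ℝ) (π : ActState G → ℝ) : Prop :=
  ∀ u i, CanAct u i → π (add u i) = nu i * π u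

/-- The product weights of the activity states. -/
def weight (nu : V → ℝ) (u : ActState G) : ℝ := ∏ i ∈ u.1, nu i

lemma weight_pos {nu : V → ℝ} (hnu : ∀ i, 0 < nu i) (u : ActState G) : 0 < weight nu u :=
  Finset.prod_pos fun i _ => hnu i

lemma reversible_weight (nu : V → ℝ) : Reversible nu (weight nu (G := G)) := by
  intro u i h
  rw [weight, add_val h, Finset.prod_insert h.1, weight]

lemma eq_idle_of_del_eq {g : ActState G → ℝ} (h : ∀ u : ActState G, ∀ i ∈ u.1, g u = g (del u i))
    (u : ActState G) : g u = g idle := by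
  induction hn : u.1.card generalizing u with
  | zero => rw [eq_idle_of_forall (u := u) (by simp [Finset.card_eq_zero.1 hn])]
  | succ n ih =>
    obtain ⟨i, hi⟩ : u.1.Nonempty := Finset.card_pos.1 (by omega)
    rw [h u i hi]
    exact ih _ (by rw [del_val, Finset.card_erase_of_mem hi, hn]; rfl)

/-- The marginal distribution of the activity state. -/
def marginal (p : PMF (NetState G)) (u : ActState G) : ℝ := (∑' x, p (u, x)).toReal

lemma marginal_nonneg (p : PMF (NetState G)) (u : ActState G) : 0 ≤ marginal p u :=
  ENNReal.toReal_nonneg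

end Weights

section Activity

variable {V : Type*} [Fintype V] {G : SimpleGraph V}

/-- The generator of the activity process. -/
def gen (nu : V → ℝ) (f : ActState G → ℝ) (u : ActState G) : ℝ :=
  ∑ i, ((if CanAct u i then nu i * (f (add u i) - f u) else 0)
    + (if i ∈ u.1 then f (del u i) - f u else 0))

/-- The Dirichlet form of the activity process with respect to `π`. -/
def dirichlet (π g f : ActState G → ℝ) : ℝ :=
  ∑ i, ∑ u, if i ∈ u.1 then π u * ((g u - g (del u i)) * (f u - f (del u i))) else 0

/-- Activations and de-activations of `i` traverse the same edges in opposite directions; detailed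
balance matches their weights. -/
lemma Reversible.sum_eq {nu : V → ℝ} {π : ActState G → ℝ} (hπ : Reversible nu π) (i : V)
    (φ : ActState G → ActState G → ℝ) :
    ∑ u, (if CanAct u i then π u * (nu i * φ u (add u i)) else 0)
      = ∑ u, if i ∈ u.1 then π u * φ (del u i) u else 0 := by
  rw [← Finset.sum_filter, ← Finset.sum_filter]
  refine Finset.sum_nbij' (fun u => add u i) (fun u => del u i) ?_ ?_ ?_ ?_ ?_
  · intro u hu
    simpa using mem_add (Finset.mem_filter.1 hu).2
  · intro u hu
    simpa using canAct_del (Finset.mem_filter.1 hu).2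
  · intro u hu
    exact del_add (Finset.mem_filter.1 hu).2
  · intro u hu
    exact add_del (Finset.mem_filter.1 hu).2
  · intro u hu
    have h := (Finset.mem_filter.1 hu).2
    rw [del_add h, hπ u i h]
    ring

/-- Summation by parts along the edges of the activity process. -/
lemma Reversible.sum_mul_gen {nu : V → ℝ} {π : ActState G → ℝ} (hπ : Reversible nu π)
    (g f : ActState G → ℝ) : ∑ u, π u * (g u * gen nu f u) = -dirichlet π g f := by
  have h1 : ∑ u, π u * (g u * gen nu f u)
      = ∑ i, (∑ u, (if CanAct u i then π u * (nu i * (g u * (f (add u i) - f u))) else 0)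
        + ∑ u, (if i ∈ u.1 then π u * (g u * (f (del u i) - f u)) else 0)) := by
    simp_rw [gen, Finset.mul_sum, ← Finset.sum_add_distrib]
    rw [Finset.sum_comm]
    refine Finset.sum_congr rfl fun i _ => Finset.sum_congr rfl fun u _ => ?_
    split_ifs <;> ring
  rw [h1, dirichlet, ← Finset.sum_neg_distrib]
  refine Finset.sum_congr rfl fun i _ => ?_
  rw [hπ.sum_eq i fun u v => g u * (f v - f u), ← Finset.sum_add_distrib,
    ← Finset.sum_neg_distrib]
  refine Finset.sum_congr rfl fun u _ => ?_
  split_ifs <;> ring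

lemma expect_activity (p : PMF (NetState G)) {φ : ActState G → ℝ} (hφ : ∀ u, 0 ≤ φ u) :
    expect p (fun s => φ s.1) = ENNReal.ofReal (∑ u, marginal p u * φ u) := by
  have hfin : ∀ u, ∑' x, p (u, x) ≠ ∞ := fun u => by
    refine ne_top_of_le_ne_top ENNReal.one_ne_top ?_
    rw [← p.tsum_coe, ENNReal.tsum_prod']
    exact ENNReal.le_tsum u
  rw [expect, ENNReal.tsum_prod', tsum_fintype, ENNReal.ofReal_sum_of_nonneg
    fun u _ => mul_nonneg (marginal_nonneg p u) (hφ u)]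
  refine Finset.sum_congr rfl fun u _ => ?_
  rw [marginal, ENNReal.ofReal_mul ENNReal.toReal_nonneg, ENNReal.ofReal_toReal (hfin u),
    ← ENNReal.tsum_mul_right]

lemma sum_marginal (p : PMF (NetState G)) : ∑ u, marginal p u = 1 := by
  have h := expect_activity p (φ := fun _ => 1) fun _ => zero_le_one
  simp only [expect, ENNReal.ofReal_one, mul_one, p.tsum_coe] at h
  exact (ENNReal.ofReal_eq_one.1 h.symm)

lemma rateSum_activity (lam nu : V → ℝ) (φ : ActState G → ℝ) (s : NetState G) :
    rateSum lam nu (fun s => φ s.1) s = totalRate lam nu s.1 * φ s.1 + gen nu φ s.1 := by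
  simp only [rateSum, totalRate, gen, Finset.sum_mul, ← Finset.sum_add_distrib]
  refine Finset.sum_congr rfl fun i _ => ?_
  split_ifs <;> ring

section Stationary

variable {lam nu : V → ℝ} {p : PMF (NetState G)}

/-- Test functions must be nonnegative, so the drift comparison is applied to `c - φ` with `c` an
upper bound of `φ`. One sign suffices below. -/
lemma IsStationary.sum_marginal_mul_gen_nonneg (hp : IsStationary G lam nu p)
    (hlam : ∀ i, 0 ≤ lam i) (hnu : ∀ i, 0 ≤ nu i) (φ : ActState G → ℝ) :
    0 ≤ ∑ u, marginal p u * gen nu φ u := by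
  obtain ⟨c, hc⟩ := (Set.finite_range φ).bddAbove
  have hc' : ∀ u, 0 ≤ c - φ u := fun u => sub_nonneg.2 (hc ⟨u, rfl⟩)
  have hgen : ∀ u, gen nu (fun u => c - φ u) u = -gen nu φ u := fun u => by
    rw [gen, gen, ← Finset.sum_neg_distrib]
    refine Finset.sum_congr rfl fun i _ => ?_
    split_ifs <;> ring
  have hmax : ∀ a : ℝ, max a 0 - max (-a) 0 = a := fun a => by
    rcases le_total a 0 with h | h
    · rw [max_eq_left (neg_nonneg.2 h), max_eq_right h]; ring
    · rw [max_eq_right (neg_nonpos.2 h), max_eq_left h]; ring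
  have h := hp.expect_le hlam hnu (F := fun s => c - φ s.1)
    (Φ := fun s => max (-gen nu φ s.1) 0) (Ψ := fun s => max (gen nu φ s.1) 0)
    (fun s => hc' _) (fun s => le_max_right _ _) (fun s => le_max_right _ _)
    (by rw [expect_activity p hc']; exact ENNReal.ofReal_ne_top)
    (fun s => by
      rw [rateSum_activity lam nu (fun u => c - φ u), hgen]
      linarith [hmax (gen nu φ s.1)])
  rw [expect_activity p (φ := fun u => max (-gen nu φ u) 0) (fun s => le_max_right _ _),
    expect_activity p (φ := fun u => max (gen nu φ u) 0) (fun s => le_max_right _ _),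
    ENNReal.ofReal_le_ofReal_iff
      (Finset.sum_nonneg fun u _ => mul_nonneg (marginal_nonneg p u) (le_max_right _ _)),
    ← sub_nonneg, ← Finset.sum_sub_distrib] at h
  refine h.trans_eq (Finset.sum_congr rfl fun u _ => ?_)
  rw [← mul_sub, hmax]

/-- The activity process has the product-form stationary distribution. -/
lemma IsStationary.marginal_eq (hp : IsStationary G lam nu p)
    (hlam : ∀ i, 0 ≤ lam i) (hnu : ∀ i, 0 < nu i) (u : ActState G) :
    marginal p u = marginal p idle * weight nu u := by
  set g : ActState G → ℝ := fun u => marginal p u / weight nu u with hg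
  have hmg : ∀ u, marginal p u = weight nu u * g u := fun u => by
    rw [hg, mul_div_cancel₀ _ (weight_pos hnu u).ne']
  have hnn : ∀ (i : V) (u : ActState G), 0 ≤
      (if i ∈ u.1 then weight nu u * ((g u - g (del u i)) * (g u - g (del u i))) else 0) := by
    intro i u
    split_ifs
    · exact mul_nonneg (weight_pos hnu u).le (mul_self_nonneg _)
    · exact le_rfl
  -- The density relative to the product weights is its own test function: its energy is at most
  -- zero, hence it is constant along every edge.
  have h0 : dirichlet (weight nu) g g ≤ 0 := by
    have h := hp.sum_marginal_mul_gen_nonneg hlam (fun i => (hnu i).le) g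
    simp_rw [hmg, mul_assoc] at h
    rw [(reversible_weight nu).sum_mul_gen] at h
    linarith
  have hdel : ∀ u : ActState G, ∀ i ∈ u.1, g u = g (del u i) := by
    intro u i hi
    have h1 : (if i ∈ u.1 then weight nu u * ((g u - g (del u i)) * (g u - g (del u i)))
        else 0) ≤ 0 :=
      calc _ ≤ ∑ u : ActState G, (if i ∈ u.1 then
              weight nu u * ((g u - g (del u i)) * (g u - g (del u i))) else 0) :=
            Finset.single_le_sum (fun u _ => hnn i u) (Finset.mem_univ u)
        _ ≤ dirichlet (weight nu) g g :=
            Finset.single_le_sum (f := fun i => ∑ u : ActState G, (if i ∈ u.1 then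
              weight nu u * ((g u - g (del u i)) * (g u - g (del u i))) else 0))
              (fun i _ => Finset.sum_nonneg fun u _ => hnn i u) (Finset.mem_univ i)
        _ ≤ 0 := h0
    rw [if_pos hi] at h1
    have h2 : (g u - g (del u i)) * (g u - g (del u i)) ≤ 0 := by
      by_contra! h
      exact absurd h1 (not_le.2 (mul_pos (weight_pos hnu u) h))
    linarith [mul_self_eq_zero.1 (le_antisymm h2 (mul_self_nonneg _))]
  have h := eq_idle_of_del_eq hdel u
  rw [hmg u, h, hg]
  simp [weight, idle, mul_comm]

lemma IsStationary.marginal_pos (hp : IsStationary G lam nu p)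
    (hlam : ∀ i, 0 ≤ lam i) (hnu : ∀ i, 0 < nu i) (u : ActState G) : 0 < marginal p u := by
  have h0 : 0 < marginal p (idle : ActState G) := by
    refine (marginal_nonneg p _).lt_of_ne fun h => ?_
    have h1 := sum_marginal p
    rw [Finset.sum_eq_zero fun u _ => by rw [hp.marginal_eq hlam hnu u, ← h, zero_mul]] at h1
    exact zero_ne_one h1
  rw [hp.marginal_eq hlam hnu]
  exact mul_pos h0 (weight_pos hnu u)

lemma IsStationary.reversible (hp : IsStationary G lam nu p)
    (hlam : ∀ i, 0 ≤ lam i) (hnu : ∀ i, 0 < nu i) : Reversible nu (marginal p) := by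
  intro u i h
  rw [hp.marginal_eq hlam hnu, hp.marginal_eq hlam hnu u, reversible_weight nu u i h]
  ring

/-! ### Rate conservation at a node -/

/-- Up- and downcrossings of level `n` by the queue at `i` balance. The bounded indicator of `n <
x_i` replaces `x_i`, whose mean may be infinite. -/
lemma IsStationary.expect_eq_level_le (hp : IsStationary G lam nu p)
    (hlam : ∀ i, 0 ≤ lam i) (hnu : ∀ i, 0 ≤ nu i) (i : V) (n : ℕ) :
    expect p (fun s => lam i * if s.2 i = n then 1 else 0)
      ≤ expect p (fun s => (if i ∈ s.1.1 then 1 else 0) * if s.2 i = n + 1 then 1 else 0) := by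
  refine hp.expect_le hlam hnu (F := fun s => if n < s.2 i then 1 else 0) (fun s => ?_)
    (fun s => ?_) (fun s => ?_) ?_ fun s => ?_
  · split_ifs <;> norm_num
  · exact mul_nonneg (hlam i) (by split_ifs <;> norm_num)
  · split_ifs <;> norm_num
  · refine ne_top_of_le_ne_top ENNReal.one_ne_top ?_
    rw [← p.tsum_coe]
    refine ENNReal.tsum_le_tsum fun s => ?_
    dsimp only
    split_ifs <;> simp
  · simp only [rateSum, totalRate, Finset.sum_mul]
    rw [← Finset.add_sum_erase _ _ (Finset.mem_univ i),
      ← Finset.add_sum_erase Finset.univ (fun j => lam j * _ + _ + _) (Finset.mem_univ i)]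
    -- Transitions at other nodes leave `x_i` unchanged, so their contributions cancel.
    have hrest : ∀ j ∈ Finset.univ.erase i,
        (lam j + (if CanAct s.1 j then nu j else 0) + (if j ∈ s.1.1 then 1 else 0))
          * (if n < s.2 i then (1 : ℝ) else 0)
        = lam j * (if n < (s.2 + Pi.single j 1 : V → ℕ) i then (1 : ℝ) else 0)
          + (if CanAct s.1 j then nu j * (if n < s.2 i then (1 : ℝ) else 0) else 0)
          + (if j ∈ s.1.1 then (if n < (s.2 - Pi.single j 1 : V → ℕ) i then (1 : ℝ) else 0) else 0) := by
      intro j hj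
      have hij : i ≠ j := (Finset.ne_of_mem_erase hj).symm
      simp only [Pi.add_apply, Pi.sub_apply, Pi.single_eq_of_ne hij, add_zero, Nat.sub_zero]
      split_ifs <;> ring
    rw [Finset.sum_congr rfl hrest]
    generalize Finset.sum (M := ℝ) (Finset.univ.erase i) _ = R
    simp only [Pi.add_apply, Pi.sub_apply, Pi.single_eq_same]
    have h1 : (if n < s.2 i + 1 then (1 : ℝ) else 0)
        = (if n < s.2 i then 1 else 0) + if s.2 i = n then 1 else 0 := by
      split_ifs <;> first | omega | norm_num
    have h2 : (if n < s.2 i then (1 : ℝ) else 0)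
        = (if n < s.2 i - 1 then 1 else 0) + if s.2 i = n + 1 then 1 else 0 := by
      split_ifs <;> first | omega | norm_num
    rw [h1, h2]
    by_cases hi : i ∈ s.1.1 <;> by_cases hc : CanAct s.1 i <;>
      simp only [if_pos, if_neg, hi, hc, not_false_eq_true] <;>
      exact le_of_eq (by ring)

/-- The arrival rate at a node is at most the rate at which it completes transmissions of
actual packets. -/
lemma IsStationary.ofReal_lam_le (hp : IsStationary G lam nu p)
    (hlam : ∀ i, 0 ≤ lam i) (hnu : ∀ i, 0 ≤ nu i) (i : V) :
    ENNReal.ofReal (lam i)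
      ≤ expect p (fun s => (if i ∈ s.1.1 then 1 else 0) * if 0 < s.2 i then 1 else 0) := by
  have h := ENNReal.tsum_le_tsum fun n => hp.expect_eq_level_le hlam hnu i n
  unfold expect at h ⊢
  rw [ENNReal.tsum_comm, ENNReal.tsum_comm (α := ℕ)] at h
  refine le_trans (le_of_eq ?_) (h.trans (ENNReal.tsum_le_tsum fun s => ?_))
  · have : ∀ s : NetState G, ∑' n : ℕ, p s * ENNReal.ofReal (lam i * if s.2 i = n then 1 else 0)
        = p s * ENNReal.ofReal (lam i) := fun s => by
      rw [tsum_eq_single (s.2 i) fun n hn => by simp [hn.symm]]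
      simp
    simp_rw [this]
    rw [ENNReal.tsum_mul_right, p.tsum_coe, one_mul]
  -- Only the level `x_i - 1` can contribute; for `x_i = 0` truncation makes this level `0`, where
  -- both sides vanish.
  · rw [tsum_eq_single (s.2 i - 1) fun n hn => by simp [show s.2 i ≠ n + 1 by omega]]
    gcongr
    dsimp only
    by_cases h : 0 < s.2 i
    · simp [h, Nat.sub_add_cancel h]
    · simp [show s.2 i ≠ s.2 i - 1 + 1 by omega, h]

lemma IsStationary.lam_le (hp : IsStationary G lam nu p)
    (hlam : ∀ i, 0 ≤ lam i) (hnu : ∀ i, 0 ≤ nu i) (i : V) :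
    lam i ≤ ∑ u : ActState G, marginal p u * if i ∈ u.1 then 1 else 0 := by
  have h := (hp.ofReal_lam_le hlam hnu i).trans (expect_mono p
    (F' := fun s => if i ∈ s.1.1 then 1 else 0) fun s => by split_ifs <;> norm_num)
  rw [expect_activity p (φ := fun u => if i ∈ u.1 then 1 else 0)
    fun u => by split_ifs <;> norm_num] at h
  refine (ENNReal.ofReal_le_ofReal_iff (Finset.sum_nonneg fun u _ =>
    mul_nonneg (marginal_nonneg p u) ?_)).1 h
  split_ifs <;> norm_num

lemma IsStationary.ofReal_lam_le_meanQueue (hp : IsStationary G lam nu p)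
    (hlam : ∀ i, 0 ≤ lam i) (hnu : ∀ i, 0 ≤ nu i) (i : V) :
    ENNReal.ofReal (lam i) ≤ meanQueue p i := by
  refine (hp.ofReal_lam_le hlam hnu i).trans (ENNReal.tsum_le_tsum fun s => ?_)
  rw [← ENNReal.ofReal_natCast]
  gcongr
  dsimp only
  split_ifs with h1 h2
  · rw [one_mul]
    exact Nat.one_le_cast.2 h2
  all_goals simp

end Stationary

end Activity

/-! ### Weighted backlog -/

section Backlog

variable {V : Type*} {G : SimpleGraph V}

/-- The weighted number of packets at the nodes in `S`. -/
def backlog (w : V → ℝ) (S : Finset V) (x : V → ℕ) : ℝ := ∑ i ∈ S, w i * (x i : ℝ)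

lemma backlog_add_single (w : V → ℝ) (S : Finset V) (x : V → ℕ) (j : V) :
    backlog w S (x + Pi.single j 1) = backlog w S x + if j ∈ S then w j else 0 := by
  rw [backlog, backlog, ← Finset.sum_ite_eq' S j w, ← Finset.sum_add_distrib]
  refine Finset.sum_congr rfl fun i _ => ?_
  by_cases h : i = j
  · subst h; simp; ring
  · simp [h]

/-- Only an inequality: a dummy transmission leaves an empty buffer empty. This is the direction a
lower bound on the backlog needs. -/
lemma backlog_le_sub_single {w : V → ℝ} (hw : ∀ i, 0 ≤ w i) (S : Finset V) (x : V → ℕ) (j : V) :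
    backlog w S x - (if j ∈ S then w j else 0) ≤ backlog w S (x - Pi.single j 1) := by
  rw [backlog, backlog, ← Finset.sum_ite_eq' S j w, ← Finset.sum_sub_distrib]
  refine Finset.sum_le_sum fun i _ => ?_
  by_cases h : i = j
  · subst h
    have : (x i : ℝ) ≤ ((x i - 1 : ℕ) : ℝ) + 1 := by exact_mod_cast (by omega : x i ≤ x i - 1 + 1)
    simp
    nlinarith [hw i]
  · simp [h]

lemma expect_backlog (p : PMF (NetState G)) {w : V → ℝ} (hw : ∀ i, 0 ≤ w i) (S : Finset V) :
    expect p (fun s => backlog w S s.2) = ∑ i ∈ S, ENNReal.ofReal (w i) * meanQueue p i := by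
  simp only [expect, backlog, meanQueue]
  rw [← Finset.sum_congr rfl fun i _ => ENNReal.tsum_mul_left,
    ← Summable.tsum_finsetSum fun _ _ => ENNReal.summable]
  refine tsum_congr fun s => ?_
  rw [ENNReal.ofReal_sum_of_nonneg fun i _ => mul_nonneg (hw i) (Nat.cast_nonneg _),
    Finset.mul_sum]
  refine Finset.sum_congr rfl fun i _ => ?_
  rw [ENNReal.ofReal_mul (hw i), ENNReal.ofReal_natCast, mul_left_comm]

end Backlog

section Resolvent

variable {V : Type*} [Fintype V] {G : SimpleGraph V}

/-! ### The killed resolvent -/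

lemma gen_add (nu : V → ℝ) (f g : ActState G → ℝ) (u : ActState G) :
    gen nu (f + g) u = gen nu f u + gen nu g u := by
  simp only [gen, ← Finset.sum_add_distrib, Pi.add_apply]
  refine Finset.sum_congr rfl fun i _ => ?_
  split_ifs <;> ring

lemma gen_smul (nu : V → ℝ) (c : ℝ) (f : ActState G → ℝ) (u : ActState G) :
    gen nu (c • f) u = c * gen nu f u := by
  simp only [gen, Finset.mul_sum, Pi.smul_apply, smul_eq_mul]
  refine Finset.sum_congr rfl fun i _ => ?_
  split_ifs <;> ring

lemma gen_nonpos {nu : V → ℝ} (hnu : ∀ i, 0 ≤ nu i) {f : ActState G → ℝ} {u : ActState G}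
    (h : ∀ v, f v ≤ f u) : gen nu f u ≤ 0 := by
  refine Finset.sum_nonpos fun i _ => add_nonpos ?_ ?_
  · split_ifs
    · exact mul_nonpos_of_nonneg_of_nonpos (hnu i) (sub_nonpos.2 (h _))
    · exact le_rfl
  · split_ifs
    · exact sub_nonpos.2 (h _)
    · exact le_rfl

lemma gen_nonneg {nu : V → ℝ} (hnu : ∀ i, 0 ≤ nu i) {f : ActState G → ℝ} {u : ActState G}
    (h : ∀ v, f u ≤ f v) : 0 ≤ gen nu f u := by
  have h1 := gen_nonpos hnu (f := (-1 : ℝ) • f) (u := u) fun v => by simpa using h v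
  rw [gen_smul] at h1
  linarith

/-- `α - gen` with zero boundary condition off `A`. -/
def killed (nu : V → ℝ) (α : ℝ) (A : Set (ActState G)) :
    (ActState G → ℝ) →ₗ[ℝ] (ActState G → ℝ) where
  toFun f u := if u ∈ A then α * f u - gen nu f u else f u
  map_add' f g := by
    ext u
    simp only [gen_add, Pi.add_apply]
    split_ifs <;> ring
  map_smul' c f := by
    ext u
    simp only [gen_smul, Pi.smul_apply, smul_eq_mul, RingHom.id_apply]
    split_ifs <;> ring

/-- Maximum principle: at a maximum of `f` inside `A` the generator is nonpositive. -/
lemma le_of_killed_le {nu : V → ℝ} (hnu : ∀ i, 0 ≤ nu i) {α : ℝ} (hα : 0 < α)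
    {A : Set (ActState G)} {f : ActState G → ℝ} {c : ℝ}
    (h : ∀ u, killed nu α A f u ≤ if u ∈ A then α * c else c) (u : ActState G) : f u ≤ c := by
  have : Nonempty (ActState G) := ⟨idle⟩
  obtain ⟨v, hv⟩ := Finite.exists_max f
  refine (hv u).trans ?_
  have h1 := h v
  simp only [killed, LinearMap.coe_mk, AddHom.coe_mk] at h1
  split_ifs at h1
  · have h2 := gen_nonpos hnu hv
    exact le_of_mul_le_mul_left (by linarith) hα
  · exact h1

/-- The maximum principle gives injectivity, hence surjectivity in finite dimension, and also both
bounds on the solution. -/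
lemma exists_resolvent {nu : V → ℝ} (hnu : ∀ i, 0 ≤ nu i) {α : ℝ} (hα : 0 < α)
    (A : Set (ActState G)) : ∃ f : ActState G → ℝ, (∀ u, 0 ≤ f u) ∧ (∀ u, f u ≤ 1 / α) ∧
      (∀ u ∉ A, f u = 0) ∧ ∀ u ∈ A, α * f u - gen nu f u = 1 := by
  have hinj : Function.Injective (killed nu α A) := by
    rw [← LinearMap.ker_eq_bot, LinearMap.ker_eq_bot']
    intro f hf
    ext u
    refine le_antisymm (le_of_killed_le hnu hα (A := A) (fun v => ?_) u) ?_
    · rw [hf]; simp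
    · have := le_of_killed_le hnu hα (A := A) (f := -f) (c := 0) (fun v => by
        rw [map_neg, hf]; simp) u
      simpa using this
  obtain ⟨f, hf⟩ := (LinearMap.injective_iff_surjective.1 hinj) (fun u => if u ∈ A then 1 else 0)
  have hf' : ∀ u, killed nu α A f u = if u ∈ A then 1 else 0 := fun u => by rw [hf]
  refine ⟨f, fun u => ?_, le_of_killed_le hnu hα (A := A) fun u => ?_, fun u hu => ?_,
    fun u hu => ?_⟩
  · have := le_of_killed_le hnu hα (A := A) (f := -f) (c := 0) (fun v => by
      rw [map_neg, Pi.neg_apply, hf']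
      split_ifs <;> simp) u
    simpa using this
  · rw [hf', mul_one_div_cancel hα.ne']
    split_ifs
    · exact le_rfl
    · positivity
  · simpa [killed, hu] using hf' u
  · simpa [killed, hu] using hf' u

/-- The mass of `A` under `π`. -/
def mass (π : ActState G → ℝ) (A : Set (ActState G)) : ℝ := ∑ u, if u ∈ A then π u else 0

lemma mass_nonneg {π : ActState G → ℝ} (hπ : ∀ u, 0 ≤ π u) (A : Set (ActState G)) :
    0 ≤ mass π A :=
  Finset.sum_nonneg fun u _ => by
    split_ifs
    · exact hπ u
    · exact le_rfl

lemma le_mass {π : ActState G → ℝ} (hπ : ∀ u, 0 ≤ π u) {A : Set (ActState G)} {u : ActState G}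
    (hu : u ∈ A) : π u ≤ mass π A := by
  calc π u = if u ∈ A then π u else 0 := (if_pos hu).symm
    _ ≤ mass π A := Finset.single_le_sum (f := fun v : ActState G => if v ∈ A then π v else 0)
        (fun v _ => ite_nonneg (hπ v) le_rfl) (Finset.mem_univ u)

/-- The probability flow out of `A`. -/
def outflow (π : ActState G → ℝ) (A : Set (ActState G)) : ℝ :=
  ∑ i, ∑ u : ActState G, if i ∈ u.1 ∧ ¬(u ∈ A ↔ del u i ∈ A) then π u else 0

/-- Pairing the resolvent equation with the indicator of `A` gives `π(A)` minus a Dirichlet form.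
That form lives on edges crossing the boundary of `A`, where `f` varies by at most `1 / α`. -/
lemma Reversible.le_sum_resolvent {nu : V → ℝ} {π : ActState G → ℝ} (hrev : Reversible nu π)
    (hπ : ∀ u, 0 ≤ π u) {α : ℝ} (hα : 0 < α) {A : Set (ActState G)} {f : ActState G → ℝ}
    (h0 : ∀ u, 0 ≤ f u) (h1 : ∀ u, f u ≤ 1 / α) (hA : ∀ u ∉ A, f u = 0)
    (hf : ∀ u ∈ A, α * f u - gen nu f u = 1)
    (hflow : 2 * outflow π A ≤ α * mass π A) :
    mass π A / (2 * α) ≤ ∑ u, π u * f u := by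
  set g : ActState G → ℝ := fun u => if u ∈ A then 1 else 0 with hg
  have hsum : α * ∑ u, π u * f u = mass π A - dirichlet π g f := by
    rw [mass, sub_eq_add_neg, ← hrev.sum_mul_gen, Finset.mul_sum, ← Finset.sum_add_distrib]
    refine Finset.sum_congr rfl fun u _ => ?_
    by_cases hu : u ∈ A
    · simp only [hg, hu, if_true]
      linear_combination π u * hf u hu
    · simp [hg, hu, hA u hu]
  have hD : dirichlet π g f ≤ 1 / α * outflow π A := by
    rw [dirichlet, outflow, Finset.mul_sum]
    refine Finset.sum_le_sum fun i _ => ?_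
    rw [Finset.mul_sum]
    refine Finset.sum_le_sum fun u _ => ?_
    have e1 : f u - f (del u i) ≤ 1 / α := by linarith [h1 u, h0 (del u i)]
    have e2 : f (del u i) - f u ≤ 1 / α := by linarith [h0 u, h1 (del u i)]
    by_cases hi : i ∈ u.1
    · by_cases hu : u ∈ A <;> by_cases hd : del u i ∈ A <;>
        simp only [hi, hu, hd, hg, if_true, if_false, true_and, not_true_eq_false,
          not_false_eq_true, iff_true, iff_false, iff_self] <;>
        nlinarith [hπ u, mul_le_mul_of_nonneg_left e1 (hπ u), mul_le_mul_of_nonneg_left e2 (hπ u)]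
    · simp [hi]
  have hD' : 1 / α * outflow π A ≤ mass π A / 2 := by
    rw [one_div, inv_mul_le_iff₀ hα]
    linarith
  rw [div_le_iff₀ (by positivity)]
  linarith

/-! ### A lower bound for the weighted mean queue lengths -/

/-- The drift of `f(U) Y(X)` is at least `Y gen f`, plus arrivals weighted by `f`, minus service
weighted by `f` after the transmission. An infinite mean backlog makes the claim trivial; otherwise
the test function is integrable. -/
lemma IsStationary.le_backlog_add {lam nu : V → ℝ} {p : PMF (NetState G)}
    (hp : IsStationary G lam nu p) (hlam : ∀ i, 0 ≤ lam i) (hnu : ∀ i, 0 ≤ nu i)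
    {w : V → ℝ} (hw : ∀ i, 0 ≤ w i) (S : Finset V) {f : ActState G → ℝ} (hf : ∀ u, 0 ≤ f u)
    (hgen : ∀ u, -1 ≤ gen nu f u) :
    ENNReal.ofReal (arrivalRate lam w S * ∑ u, marginal p u * f u)
      ≤ (∑ i ∈ S, ENNReal.ofReal (w i) * meanQueue p i)
        + ENNReal.ofReal (∑ u : ActState G,
            marginal p u * ∑ i ∈ S, if i ∈ u.1 then w i * f (del u i) else 0) := by
  rcases eq_or_ne (∑ i ∈ S, ENNReal.ofReal (w i) * meanQueue p i) ∞ with htop | htop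
  · rw [htop, top_add]; exact le_top
  have hY : ∀ x, 0 ≤ backlog w S x := fun x =>
    Finset.sum_nonneg fun i _ => mul_nonneg (hw i) (Nat.cast_nonneg _)
  have harr : 0 ≤ arrivalRate lam w S := Finset.sum_nonneg fun i _ => mul_nonneg (hw i) (hlam i)
  have hcross : ∀ u : ActState G, 0 ≤ ∑ i ∈ S, if i ∈ u.1 then w i * f (del u i) else 0 :=
    fun u => Finset.sum_nonneg fun i _ => by
      split_ifs
      · exact mul_nonneg (hw i) (hf _)
      · exact le_rfl
  have key := hp.expect_le hlam hnu (F := fun s => f s.1 * backlog w S s.2)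
    (Φ := fun s => arrivalRate lam w S * f s.1)
    (Ψ := fun s => backlog w S s.2 + ∑ i ∈ S, if i ∈ s.1.1 then w i * f (del s.1 i) else 0)
    (fun s => mul_nonneg (hf _) (hY _)) (fun s => mul_nonneg harr (hf _))
    (fun s => add_nonneg (hY _) (hcross _)) ?_ fun s => ?_
  · rw [expect_add p (F := fun s => backlog w S s.2)
        (F' := fun s => ∑ i ∈ S, if i ∈ s.1.1 then w i * f (del s.1 i) else 0)
        (fun s => hY _) (fun s => hcross _), expect_backlog p hw S,
      expect_activity p (φ := fun u => arrivalRate lam w S * f u)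
        (fun u => mul_nonneg harr (hf _)),
      expect_activity p (φ := fun u => ∑ i ∈ S, if i ∈ u.1 then w i * f (del u i) else 0)
        hcross] at key
    rw [Finset.mul_sum]
    simpa only [mul_left_comm] using key
  · obtain ⟨c, hc⟩ := (Set.finite_range f).bddAbove
    have hc' : ∀ u, f u ≤ c := fun u => hc ⟨u, rfl⟩
    rw [← expect_backlog p hw S] at htop
    refine ne_top_of_le_ne_top (ENNReal.mul_ne_top (ENNReal.ofReal_ne_top (r := c)) htop) ?_
    unfold expect
    rw [← ENNReal.tsum_mul_left]
    refine ENNReal.tsum_le_tsum fun s => ?_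
    rw [ENNReal.ofReal_mul (hf _), mul_left_comm]
    gcongr
    exact hc' _
  · have hsum : totalRate lam nu s.1 * (f s.1 * backlog w S s.2) + gen nu f s.1 * backlog w S s.2
        + arrivalRate lam w S * f s.1
        - (∑ i ∈ S, if i ∈ s.1.1 then w i * f (del s.1 i) else 0)
        ≤ rateSum lam nu (fun s => f s.1 * backlog w S s.2) s := by
      have e1 : arrivalRate lam w S = ∑ j, if j ∈ S then w j * lam j else 0 := by
        simp [arrivalRate]
      have e2 : (∑ i ∈ S, if i ∈ s.1.1 then w i * f (del s.1 i) else 0)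
          = ∑ j, if j ∈ S then (if j ∈ s.1.1 then w j * f (del s.1 j) else 0) else 0 := by
        simp
      rw [e1, e2]
      simp only [totalRate, gen, rateSum, Finset.sum_mul, ← Finset.sum_add_distrib,
        ← Finset.sum_sub_distrib]
      refine Finset.sum_le_sum fun j _ => ?_
      rw [backlog_add_single]
      have e3 := mul_le_mul_of_nonneg_left (backlog_le_sub_single hw S s.2 j) (hf (del s.1 j))
      by_cases hj : j ∈ S <;> by_cases hi : j ∈ s.1.1 <;> by_cases hc : CanAct s.1 j <;>
        simp only [hj, hi, hc, if_true, if_false] at e3 ⊢ <;> nlinarith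
    nlinarith [mul_le_mul_of_nonneg_right (hgen s.1) (hY s.2)]

/-- If the flow out of `A` is small and every de-activation of a node of `S` leading into `A`
starts in a state of the rare set `R`, then the mean queue lengths are large. -/
lemma IsStationary.le_backlog {lam nu : V → ℝ} {p : PMF (NetState G)}
    (hp : IsStationary G lam nu p) (hlam : ∀ i, 0 ≤ lam i) (hnu : ∀ i, 0 < nu i)
    {w : V → ℝ} (hw : ∀ i, 0 ≤ w i) (S : Finset V) {α : ℝ} (hα : 0 < α) {A R : Set (ActState G)}
    (hflow : 2 * outflow (marginal p) A ≤ α * mass (marginal p) A)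
    (hrare : ∀ i ∈ S, ∀ u : ActState G, i ∈ u.1 → del u i ∈ A → u ∈ R) :
    ENNReal.ofReal (arrivalRate lam w S * (mass (marginal p) A / (2 * α))
        - (∑ i ∈ S, w i) * mass (marginal p) R / α)
      ≤ ∑ i ∈ S, ENNReal.ofReal (w i) * meanQueue p i := by
  have hnu' : ∀ i, 0 ≤ nu i := fun i => (hnu i).le
  obtain ⟨f, h0, h1, hA, hf⟩ := exists_resolvent hnu' hα A
  -- Inside `A` the equation gives `gen f = α f - 1`; outside, `f` is at its minimum `0`.
  have hgen : ∀ u, -1 ≤ gen nu f u := fun u => by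
    by_cases hu : u ∈ A
    · have := hf u hu
      nlinarith [h0 u]
    · linarith [gen_nonneg hnu' (f := f) (u := u) fun v => by rw [hA u hu]; exact h0 v]
  have key := hp.le_backlog_add hlam hnu' hw S h0 hgen
  have harr : 0 ≤ arrivalRate lam w S := Finset.sum_nonneg fun i _ => mul_nonneg (hw i) (hlam i)
  have hE := (hp.reversible hlam hnu).le_sum_resolvent (marginal_nonneg p) hα h0 h1 hA hf hflow
  have hcross : (∑ u : ActState G,
      marginal p u * ∑ i ∈ S, if i ∈ u.1 then w i * f (del u i) else 0)
      ≤ (∑ i ∈ S, w i) * mass (marginal p) R / α := by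
    rw [mass, mul_div_assoc, Finset.sum_div, Finset.mul_sum]
    refine Finset.sum_le_sum fun u _ => ?_
    have : (∑ i ∈ S, if i ∈ u.1 then w i * f (del u i) else 0)
        ≤ ∑ i ∈ S, w i * ((if u ∈ R then 1 else 0) / α) := by
      refine Finset.sum_le_sum fun i hi => ?_
      split_ifs with hu hR hR
      · exact mul_le_mul_of_nonneg_left (h1 _) (hw i)
      · rw [hA _ fun h => hR (hrare i hi u hu h)]; simp
      · have := hw i; positivity
      · simp
    refine (mul_le_mul_of_nonneg_left this (marginal_nonneg p u)).trans_eq ?_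
    rw [← Finset.sum_mul]
    split_ifs <;> ring
  rw [ENNReal.ofReal_sub _ (div_nonneg (mul_nonneg (Finset.sum_nonneg fun i _ => hw i)
    (mass_nonneg (marginal_nonneg p) R)) hα.le), tsub_le_iff_right]
  refine (ENNReal.ofReal_le_ofReal (mul_le_mul_of_nonneg_left hE harr)).trans (key.trans ?_)
  gcongr

end Resolvent

/-! ### Partite graphs -/

section Clique

variable {V : Type*} {G : SimpleGraph V} {K : ℕ} {C : G.Coloring (Fin K)}

/-- A clique of size `K` has exactly one node in each component. -/
lemma sum_clique {Q : Finset V} (hQ : G.IsNClique K Q) (f : Fin K → ℝ) :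
    ∑ i ∈ Q, f (C i) = ∑ k, f k := by
  have hinj : Set.InjOn C (Q : Set V) := by
    intro i hi j hj h
    by_contra hij
    exact C.valid (hQ.1 hi hj hij) h
  rw [← Finset.sum_image hinj]
  congr 1
  apply Finset.eq_univ_of_card
  rw [Finset.card_image_of_injOn hinj, hQ.2, Fintype.card_fin]

end Clique

section Partite

variable {V : Type*} [Fintype V] {G : SimpleGraph V} {K : ℕ} {C : G.Coloring (Fin K)}

lemma mem_comp {k : Fin K} {i : V} : i ∈ comp C k ↔ C i = k := by simp [comp]

lemma compSize_pos (hC : Function.Surjective C) (k : Fin K) : 0 < compSize C k := by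
  obtain ⟨i, hi⟩ := hC k
  exact Finset.card_pos.2 ⟨i, mem_comp.2 hi⟩

lemma compSize_pos_of_color (C : G.Coloring (Fin K)) (i : V) : 0 < compSize C (C i) :=
  Finset.card_pos.2 ⟨i, mem_comp.2 rfl⟩

lemma compSize_le_maxSize (C : G.Coloring (Fin K)) (k : Fin K) : compSize C k ≤ maxSize C :=
  Finset.le_sup (f := compSize C) (Finset.mem_univ k)

lemma sum_comp (C : G.Coloring (Fin K)) (f : Fin K → V → ℝ) :
    ∑ k, ∑ i ∈ comp C k, f k i = ∑ i, f (C i) i := by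
  simp only [comp, Finset.sum_filter]
  rw [Finset.sum_comm]
  exact Finset.sum_congr rfl fun i _ => by simp

lemma H_eq (C : G.Coloring (Fin K)) (u : ActState G) :
    H C u = ∑ i ∈ u.1, 1 / (compSize C (C i) : ℝ) := by
  rw [H, sum_comp C fun k i => (if i ∈ u.1 then (1 : ℝ) else 0) / (compSize C k : ℝ)]
  simp [ite_div, Finset.sum_ite_mem]

lemma H_nonneg (C : G.Coloring (Fin K)) (u : ActState G) : 0 ≤ H C u := by
  rw [H_eq]
  exact Finset.sum_nonneg fun i _ => by positivity

lemma H_lt_add {u : ActState G} {i : V} (h : CanAct u i) : H C u < H C (add u i) := by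
  rw [H_eq, H_eq, add_val h, Finset.sum_insert h.1]
  have : (0 : ℝ) < compSize C (C i) := Nat.cast_pos.2 (compSize_pos_of_color C i)
  have : 0 < 1 / (compSize C (C i) : ℝ) := by positivity
  linarith

lemma H_fullState (hC : Function.Surjective C) (k : Fin K) : H C (fullState C k) = 1 := by
  have hk : (compSize C k : ℝ) ≠ 0 := Nat.cast_ne_zero.2 (compSize_pos hC k).ne'
  rw [H_eq, Finset.sum_congr rfl fun i hi => by rw [mem_comp.1 hi]]
  rw [Finset.sum_const, nsmul_eq_mul]
  exact mul_one_div_cancel hk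

lemma card_le_maxSize_mul_H (C : G.Coloring (Fin K)) (u : ActState G) :
    (u.1.card : ℝ) ≤ maxSize C * H C u := by
  rw [H_eq, Finset.mul_sum, Finset.card_eq_sum_ones, Nat.cast_sum]
  refine Finset.sum_le_sum fun i _ => ?_
  have h0 : (0 : ℝ) < compSize C (C i) := Nat.cast_pos.2 (compSize_pos_of_color C i)
  have h1 : (compSize C (C i) : ℝ) ≤ maxSize C := Nat.cast_le.2 (compSize_le_maxSize C _)
  rw [mul_one_div, Nat.cast_one, one_le_div h0]
  exact h1

lemma not_canAct_fullState (hC : Function.Surjective C) (hH : JointActivityInefficient C)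
    (k : Fin K) (i : V) : ¬ CanAct (fullState C k) i := fun h => by
  have h1 := H_lt_add (C := C) h
  rw [H_fullState hC] at h1
  exact absurd (hH _).1 (not_le.2 h1)

lemma idle_notMem_fullStates (hC : Function.Surjective C) :
    (idle : ActState G) ∉ fullStates C := by
  rintro ⟨k, hk⟩
  have h := H_fullState hC k
  rw [hk, H_eq] at h
  simp [idle] at h

lemma H_le_of_notMem {u : ActState G} (hu : u ∉ fullStates C) : H C u ≤ 1 - zeta C := by
  rw [zeta, sub_sub_cancel]
  exact le_csSup (Set.toFinite _).bddAbove ⟨u, hu, rfl⟩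

lemma zeta_pos (hC : Function.Surjective C) (hH : JointActivityInefficient C) : 0 < zeta C := by
  have hne : (H C '' (fullStates C)ᶜ).Nonempty := ⟨_, idle, idle_notMem_fullStates hC, rfl⟩
  obtain ⟨u, hu, h⟩ := hne.csSup_mem (Set.toFinite _)
  rw [zeta, ← h, sub_pos]
  exact (hH u).2 hu

lemma zeta_le_one (hC : Function.Surjective C) : zeta C ≤ 1 := by
  have := H_le_of_notMem (idle_notMem_fullStates hC)
  linarith [H_nonneg C idle]

/-! ### The stationary distribution at high load -/

section Load

variable {lam nu : V → ℝ} {p : PMF (NetState G)} {rhoHat : Fin K → ℝ}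

/-- The load is at most the mean of `H`, which loses at least `ζ` outside `Ω*`. -/
lemma IsStationary.load_le (hp : IsStationary G lam nu p) (hlam : ∀ i, 0 ≤ lam i)
    (hnu : ∀ i, 0 ≤ nu i) (hC : Function.Surjective C) (hH : JointActivityInefficient C)
    (hrho : ∀ i, lam i = rhoHat (C i)) :
    ∑ k, rhoHat k
      ≤ 1 - zeta C * mass (marginal p) (fullStates C)ᶜ := by
  have h1 : ∑ k, rhoHat k ≤ ∑ u, marginal p u * H C u := by
    calc ∑ k, rhoHat k = ∑ k, ∑ i ∈ comp C k, rhoHat k / compSize C k := by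
          refine Finset.sum_congr rfl fun k _ => ?_
          have hk : (compSize C k : ℝ) ≠ 0 := Nat.cast_ne_zero.2 (compSize_pos hC k).ne'
          rw [Finset.sum_const, nsmul_eq_mul]
          exact (mul_div_cancel₀ _ hk).symm
      _ = ∑ i, lam i / compSize C (C i) := by
          rw [sum_comp C fun k _ => rhoHat k / compSize C k]
          exact Finset.sum_congr rfl fun i _ => by rw [hrho]
      _ ≤ ∑ i, (∑ u : ActState G, marginal p u * if i ∈ u.1 then 1 else 0)
            / compSize C (C i) := by
          refine Finset.sum_le_sum fun i _ => ?_
          gcongr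
          exact hp.lam_le hlam hnu i
      _ = ∑ u, marginal p u * H C u := by
          simp_rw [Finset.sum_div]
          rw [Finset.sum_comm]
          refine Finset.sum_congr rfl fun u _ => ?_
          rw [H_eq, Finset.mul_sum]
          simp [Finset.sum_ite_mem, div_eq_mul_inv]
  refine h1.trans ?_
  rw [mass, ← sum_marginal p, Finset.mul_sum, ← Finset.sum_sub_distrib]
  refine Finset.sum_le_sum fun u _ => ?_
  by_cases hu : u ∈ (fullStates C)ᶜ
  · rw [if_pos hu]
    nlinarith [H_le_of_notMem hu, marginal_nonneg p u]
  · rw [if_neg hu]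
    nlinarith [(hH u).1, marginal_nonneg p u]

lemma IsStationary.load_lt_one (hp : IsStationary G lam nu p) (hlam : ∀ i, 0 ≤ lam i)
    (hnu : ∀ i, 0 < nu i) (hC : Function.Surjective C) (hH : JointActivityInefficient C)
    (hrho : ∀ i, lam i = rhoHat (C i)) : ∑ k, rhoHat k < 1 := by
  refine (hp.load_le hlam (fun i => (hnu i).le) hC hH hrho).trans_lt (sub_lt_self _ ?_)
  exact mul_pos (zeta_pos hC hH) ((hp.marginal_pos hlam hnu idle).trans_le
    (le_mass (marginal_nonneg p) (idle_notMem_fullStates hC)))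

/-- At most one node of a clique through `i` is active, and none is when `i` can be activated; the
latter thus has probability at most `1 - ρ`. Detailed balance turns this into a bound on the
activity of `i`. -/
lemma IsStationary.lam_le_mul (hp : IsStationary G lam nu p) (hlam : ∀ i, 0 ≤ lam i)
    (hnu : ∀ i, 0 < nu i) (hclique : ∀ i : V, ∃ Q : Finset V, i ∈ Q ∧ G.IsNClique K Q)
    (hrho : ∀ i, lam i = rhoHat (C i)) (i : V) : lam i ≤ nu i * (1 - ∑ k, rhoHat k) := by
  obtain ⟨Q, hiQ, hQ⟩ := hclique i
  have h1 := (hp.reversible hlam hnu).sum_eq i fun _ _ => 1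
  have h2 : ∑ j ∈ Q, lam j ≤ ∑ u : ActState G, marginal p u * ∑ j ∈ Q, if j ∈ u.1 then 1 else 0 := by
    simp_rw [Finset.mul_sum]
    rw [Finset.sum_comm]
    exact Finset.sum_le_sum fun j _ => hp.lam_le hlam (fun i => (hnu i).le) j
  have h3 : ∀ u : ActState G, (∑ j ∈ Q, if j ∈ u.1 then (1 : ℝ) else 0)
      + (if CanAct u i then 1 else 0) ≤ 1 := by
    intro u
    by_cases hj : ∃ j ∈ Q, j ∈ u.1
    · obtain ⟨j, hjQ, hju⟩ := hj
      have hc : ¬ CanAct u i := fun hc => by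
        rcases eq_or_ne i j with rfl | hij
        · exact hc.1 hju
        · exact hc.2 j (hQ.1 hiQ hjQ hij) hju
      rw [if_neg hc, add_zero, Finset.sum_eq_single_of_mem j hjQ, if_pos hju]
      intro l hl hlj
      exact if_neg fun hlu => u.2 hlu hju hlj (hQ.1 hl hjQ hlj)
    · push Not at hj
      rw [Finset.sum_eq_zero fun j hjQ => if_neg (hj j hjQ), zero_add]
      split_ifs <;> norm_num
  have h4 : (∑ u : ActState G, marginal p u * ∑ j ∈ Q, if j ∈ u.1 then 1 else 0)
      + (∑ u : ActState G, marginal p u * if CanAct u i then 1 else 0) ≤ 1 := by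
    rw [← Finset.sum_add_distrib]
    refine le_of_le_of_eq (Finset.sum_le_sum fun u _ => ?_) (sum_marginal p)
    rw [← mul_add]
    exact mul_le_of_le_one_right (marginal_nonneg p u) (h3 u)
  have h5 : ∑ j ∈ Q, lam j = ∑ k, rhoHat k := by
    rw [← sum_clique (C := C) hQ]
    exact Finset.sum_congr rfl fun j _ => hrho j
  have h6 : ∑ u : ActState G, (marginal p u * if i ∈ u.1 then 1 else 0)
      = nu i * ∑ u : ActState G, marginal p u * if CanAct u i then 1 else 0 := by
    rw [Finset.mul_sum]
    convert h1.symm using 2 with u _ u _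
    · simp
    · split_ifs <;> ring
  have h7 := hp.lam_le hlam (fun i => (hnu i).le) i
  rw [h6] at h7
  exact h7.trans (mul_le_mul_of_nonneg_left (by linarith) (hnu i).le)

/-- Within `Ω*`, a node of `V_l` is active only in `v^(l)`. -/
lemma IsStationary.le_marginal_fullState (hp : IsStationary G lam nu p) (hlam : ∀ i, 0 ≤ lam i)
    (hnu : ∀ i, 0 ≤ nu i) (hC : Function.Surjective C) (hrho : ∀ i, lam i = rhoHat (C i))
    (l : Fin K) :
    rhoHat l - mass (marginal p) (fullStates C)ᶜ
      ≤ marginal p (fullState C l) := by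
  obtain ⟨i, rfl⟩ := hC l
  rw [← hrho, sub_le_iff_le_add]
  refine (hp.lam_le hlam hnu i).trans ?_
  have h : ∑ u, (if u = fullState C (C i) then marginal p u else 0)
      = marginal p (fullState C (C i)) := by simp
  rw [← h, mass, ← Finset.sum_add_distrib]
  refine Finset.sum_le_sum fun u _ => ?_
  have h0 := marginal_nonneg p u
  by_cases hu : u ∈ (fullStates C)ᶜ
  · rw [if_pos hu]
    split_ifs <;> simp [h0]
  · obtain ⟨k, rfl⟩ := not_not.1 hu
    by_cases hi : i ∈ (fullState C k).1
    · obtain rfl := mem_comp.1 hi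
      rw [if_pos rfl]
      split_ifs
      all_goals simp
    · rw [if_neg hi, mul_zero]
      refine add_nonneg ?_ ?_ <;> split_ifs <;> simp [h0]

/-- The stationary probability of an activity state is at most geometric in `1 - H`. -/
lemma IsStationary.marginal_le_rpow (hp : IsStationary G lam nu p) (hlam : ∀ i, 0 ≤ lam i)
    (hnu : ∀ i, 0 < nu i) (hcomp : ∀ i j, C i = C j → nu i = nu j)
    (hC : Function.Surjective C) (hH : JointActivityInefficient C) {r : ℝ} (hr : 0 < r)
    (hle : ∀ i, 1 ≤ nu i * r) (hK : 0 < K) (u : ActState G) :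
    marginal p u ≤ r ^ ((maxSize C : ℝ) * (1 - H C u)) := by
  set m := marginal p (idle : ActState G)
  have hm : 0 < m := hp.marginal_pos hlam hnu _
  have hlog : ∀ u : ActState G, Real.log (marginal p u)
      = Real.log m + ∑ i ∈ u.1, Real.log (nu i) := fun u => by
    rw [hp.marginal_eq hlam hnu, Real.log_mul hm.ne' (weight_pos hnu u).ne', weight,
      Real.log_prod fun i _ => (hnu i).ne']
  -- A full state has probability at most one.
  have hfull : ∀ i, compSize C (C i) * Real.log (nu i) ≤ -Real.log m := fun i => by
    have h1 : Real.log (marginal p (fullState C (C i))) ≤ 0 := by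
      refine Real.log_nonpos (marginal_nonneg p _) ?_
      rw [← sum_marginal p]
      exact Finset.single_le_sum (fun u _ => marginal_nonneg p u) (Finset.mem_univ _)
    rw [hlog, Finset.sum_congr rfl fun j hj => by rw [hcomp j i (mem_comp.1 hj)],
      Finset.sum_const, nsmul_eq_mul] at h1
    change _ + (compSize C (C i) : ℝ) * _ ≤ 0 at h1
    linarith
  obtain ⟨k, -, hk⟩ := Finset.exists_mem_eq_sup Finset.univ ⟨(⟨0, hK⟩ : Fin K), Finset.mem_univ _⟩
    (compSize C)
  change maxSize C = compSize C k at hk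
  obtain ⟨i, rfl⟩ := hC k
  have hr' : -Real.log r ≤ Real.log (nu i) := by
    rw [← Real.log_inv]
    exact Real.log_le_log (inv_pos.2 hr) ((inv_le_iff_one_le_mul₀ hr).2 (hle i))
  have hsum : ∑ i ∈ u.1, Real.log (nu i) ≤ H C u * -Real.log m := by
    rw [H_eq, Finset.sum_mul]
    refine Finset.sum_le_sum fun i _ => ?_
    have : (0 : ℝ) < compSize C (C i) := Nat.cast_pos.2 (compSize_pos_of_color C i)
    rw [one_div, ← div_eq_inv_mul, le_div_iff₀' this]
    exact hfull i
  have h1H : 0 ≤ 1 - H C u := sub_nonneg.2 (hH u).1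
  -- The largest component gives the idle state probability at most `r ^ M`.
  have hM : (maxSize C : ℝ) * -Real.log r ≤ -Real.log m := by
    rw [hk]
    exact (mul_le_mul_of_nonneg_left hr' (Nat.cast_nonneg _)).trans (hfull i)
  rw [← Real.log_le_log_iff (hp.marginal_pos hlam hnu u) (Real.rpow_pos_of_pos hr _),
    Real.log_rpow hr, hlog]
  nlinarith [mul_le_mul_of_nonneg_left hM h1H]

end Load

end Partite

/-! ### Paths and bottleneck sets -/

section Paths

variable {V : Type*} {G : SimpleGraph V}

lemma Step.symm {u v : ActState G} (h : Step u v) : Step v u := by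
  rcases h with ⟨i, hi, h⟩ | ⟨i, hi, h⟩
  · exact Or.inr ⟨i, by simp [h], by rw [h, Finset.erase_insert hi]⟩
  · exact Or.inl ⟨i, by simp [h], by rw [h, Finset.insert_erase hi]⟩

lemma IsPath.rev {n : ℕ} {q : Fin (n + 1) → ActState G} {u v : ActState G} (h : IsPath q u v) :
    IsPath (q ∘ Fin.rev) v u := by
  refine ⟨by simpa using h.2.1, by simpa using h.1, fun k => ?_⟩
  simp only [Function.comp_apply, Fin.rev_castSucc, Fin.rev_succ]
  exact (h.2.2 k.rev).symm

lemma IsPath.snoc {n : ℕ} {q : Fin (n + 1) → ActState G} {u v v' : ActState G}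
    (h : IsPath q u v) (hv : Step v v') : IsPath (Fin.snoc (α := fun _ => ActState G) q v') u v' := by
  refine ⟨?_, by simp, fun k => ?_⟩
  · rw [← Fin.castSucc_zero, Fin.snoc_castSucc]
    exact h.1
  · induction k using Fin.lastCases with
    | last => rw [Fin.snoc_castSucc, Fin.succ_last, Fin.snoc_last, h.2.1]; exact hv
    | cast k => rw [Fin.snoc_castSucc, Fin.succ_castSucc, Fin.snoc_castSucc]; exact h.2.2 k

end Paths

/-! ### Drift of the set `S` -/

section Drift

variable {V : Type*} {G : SimpleGraph V} {lam w : V → ℝ} {S : Finset V}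

lemma add_mem_Delta (hw : ∀ i, 0 ≤ w i) {u : ActState G} (hu : u ∈ Delta G lam w S) {i : V}
    (hi : CanAct u i) : add u i ∈ Delta G lam w S := by
  refine le_trans (show arrivalRate lam w S ≤ serviceRate w S u from hu) ?_
  refine Finset.sum_le_sum fun j _ => mul_le_mul_of_nonneg_left ?_ (hw j)
  rw [add_val hi]
  by_cases hj : j ∈ u.1
  · simp [hj]
  · rw [if_neg hj]
    split_ifs <;> norm_num

lemma arrivalRate_pos (hw : ∀ i, 0 ≤ w i) (hlam : ∀ i, 0 < lam i) (hwS : ∃ i ∈ S, 0 < w i) :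
    0 < arrivalRate lam w S := by
  obtain ⟨i, hi, hwi⟩ := hwS
  exact Finset.sum_pos' (fun j _ => mul_nonneg (hw j) (hlam j).le) ⟨i, hi, mul_pos hwi (hlam i)⟩

lemma drift_le_arrivalRate (hw : ∀ i, 0 ≤ w i) : drift G lam w S ≤ arrivalRate lam w S := by
  refine sub_le_self _ (Real.sSup_nonneg ?_)
  rintro _ ⟨u, -, rfl⟩
  exact Finset.sum_nonneg fun i _ => mul_nonneg (hw i) (by split_ifs <;> norm_num)

lemma drift_nonneg (hpos : 0 < arrivalRate lam w S) : 0 ≤ drift G lam w S := by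
  refine sub_nonneg.2 (Real.sSup_le ?_ hpos.le)
  rintro _ ⟨u, hu, rfl⟩
  exact (lt_of_not_ge (show ¬ arrivalRate lam w S ≤ serviceRate w S u from hu)).le

end Drift

/-! ### Bottleneck sets and the flow across their boundaries -/

section Bottleneck

variable {V : Type*} [Fintype V] {G : SimpleGraph V} {K : ℕ} {C : G.Coloring (Fin K)}

lemma le_pathMaxMin {u v : ActState G} {n : ℕ} {q : Fin (n + 1) → ActState G}
    (h : IsPath q u v) : pathMin C q ≤ pathMaxMin C u v := by
  rw [pathMaxMin]
  split_ifs
  · exact le_top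
  · exact le_iSup_of_le n (le_iSup_of_le q (le_iSup_of_le h le_rfl))

lemma pathMaxMin_le {u v : ActState G} (huv : u ≠ v) {c : EReal}
    (h : ∀ (n : ℕ) (q : Fin (n + 1) → ActState G), IsPath q u v → pathMin C q ≤ c) :
    pathMaxMin C u v ≤ c := by
  rw [pathMaxMin, if_neg huv]
  exact iSup_le fun n => iSup_le fun q => iSup_le (h n q)

lemma pathMaxMin_le_H {u v : ActState G} (huv : u ≠ v) :
    pathMaxMin C u v ≤ (H C u : EReal) :=
  pathMaxMin_le huv fun n q h => (iInf_le _ 0).trans_eq (by rw [h.1])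

lemma pathMaxMin_comm (u v : ActState G) : pathMaxMin C u v = pathMaxMin C v u := by
  have key : ∀ u v : ActState G, pathMaxMin C u v ≤ pathMaxMin C v u := fun u v => by
    rcases eq_or_ne u v with rfl | huv
    · exact le_rfl
    · refine pathMaxMin_le huv fun n q h => le_trans ?_ (le_pathMaxMin h.rev)
      exact le_iInf fun k => iInf_le _ _
  exact (key u v).antisymm (key v u)

/-- A path extended by an uphill step keeps its minimum. The case `u = v` is excluded because `M(u,
u) = ∞`. -/
lemma pathMaxMin_le_of_step {u v v' : ActState G} (huv : u ≠ v) (hstep : Step v v')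
    (hH : H C v ≤ H C v') : pathMaxMin C u v ≤ pathMaxMin C u v' := by
  refine pathMaxMin_le huv fun n q h => le_trans ?_ (le_pathMaxMin (h.snoc hstep))
  refine le_iInf fun k => ?_
  induction k using Fin.lastCases with
  | last =>
    rw [Fin.snoc_last]
    refine (iInf_le _ (Fin.last n)).trans ?_
    rw [h.2.1]
    exact EReal.coe_le_coe_iff.2 hH
  | cast k => rw [Fin.snoc_castSucc]; exact iInf_le _ k

section Levels

variable {lam w : V → ℝ} {S : Finset V} {k : Fin K}

lemma fullState_mem_Delta (hw : ∀ i, 0 ≤ w i) (hlam : ∀ i, lam i ≤ 1) (hS : S ⊆ comp C k) :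
    fullState C k ∈ Delta G lam w S := by
  refine Finset.sum_le_sum fun i hi => mul_le_mul_of_nonneg_left ?_ (hw i)
  rw [if_pos (show i ∈ (fullState C k).1 from hS hi)]
  exact hlam i

lemma fullState_notMem_Delta (hpos : 0 < arrivalRate lam w S) (hS : S ⊆ comp C k) {l : Fin K}
    (hl : l ≠ k) : fullState C l ∉ Delta G lam w S := by
  refine not_le.2 (lt_of_eq_of_lt ?_ hpos)
  refine Finset.sum_eq_zero fun i hi => ?_
  rw [if_neg, mul_zero]
  exact fun h => hl ((mem_comp.1 h).symm.trans (mem_comp.1 (hS hi)))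

lemma levelOther_le (hH : JointActivityInefficient C) (hpos : 0 < arrivalRate lam w S)
    (hS : S ⊆ comp C k) {l : Fin K} (hl : l ≠ k) : levelOther C lam w S l ≤ 1 := by
  refine iSup₂_le fun u hu => ?_
  have hne : fullState C l ≠ u := fun h => fullState_notMem_Delta hpos hS hl (h.symm ▸ hu)
  refine (pathMaxMin_le_H hne).trans ?_
  exact_mod_cast (hH _).1

lemma levelOwn_le (hH : JointActivityInefficient C) (hpos : 0 < arrivalRate lam w S)
    (hS : S ⊆ comp C k) : levelOwn C lam w S k ≤ 1 :=
  iSup₂_le fun _ hl => levelOther_le hH hpos hS hl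

lemma one_lt_top : (1 : EReal) < ⊤ := EReal.coe_lt_top 1

lemma fullState_mem_bottleneckSet (hH : JointActivityInefficient C)
    (hpos : 0 < arrivalRate lam w S) (hS : S ⊆ comp C k)
    (hk : fullState C k ∈ Delta G lam w S) (l : Fin K) :
    fullState C l ∈ bottleneckSet C lam w S k l := by
  rw [bottleneckSet]
  split_ifs with hl
  · subst hl
    refine ((levelOwn_le hH hpos hS).trans_lt one_lt_top).trans_le ?_
    exact le_iSup₂_of_le _ hk (by simp [pathMaxMin])
  · refine ((levelOther_le hH hpos hS hl).trans_lt one_lt_top).trans_le ?_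
    simp [pathMaxMin]

lemma fullState_notMem_bottleneckSet (hk : fullState C k ∈ Delta G lam w S) {l : Fin K}
    (hl : l ≠ k) : fullState C k ∉ bottleneckSet C lam w S k l := by
  rw [bottleneckSet, if_neg hl]
  exact (le_iSup₂_of_le (f := fun u (_ : u ∈ Delta G lam w S) => pathMaxMin C (fullState C l) u)
    _ hk le_rfl).not_gt

lemma fullState_notMem_bottleneckSet_own {l : Fin K} (hl : l ≠ k) :
    fullState C l ∉ bottleneckSet C lam w S k k := by
  rw [bottleneckSet, if_pos rfl]
  refine (iSup₂_le fun u hu => ?_ : (⨆ u ∈ Delta G lam w S, pathMaxMin C u (fullState C l))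
    ≤ levelOwn C lam w S k).not_gt
  rw [pathMaxMin_comm]
  exact (le_iSup₂_of_le u hu le_rfl).trans
    (le_iSup₂_of_le (f := fun l (_ : l ≠ k) => levelOther C lam w S l) l hl le_rfl)

lemma add_mem_bottleneckSet (hC : Function.Surjective C) (hH : JointActivityInefficient C)
    (hw : ∀ i, 0 ≤ w i) {l : Fin K} {u : ActState G} (hu : u ∈ bottleneckSet C lam w S k l)
    {i : V} (hi : CanAct u i) : add u i ∈ bottleneckSet C lam w S k l := by
  rw [bottleneckSet] at hu ⊢
  split_ifs at hu ⊢ with hl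
  · obtain ⟨v, hu⟩ := lt_iSup_iff.1 (show levelOwn C lam w S k <
      ⨆ v ∈ Delta G lam w S, pathMaxMin C v u from hu)
    obtain ⟨hv, hu⟩ := lt_iSup_iff.1 hu
    rcases eq_or_ne v u with rfl | hvu
    · refine lt_of_lt_of_le hu (le_iSup₂_of_le _ (add_mem_Delta hw hv hi) ?_)
      simp [pathMaxMin]
    · exact lt_of_lt_of_le hu (le_iSup₂_of_le v hv
        (pathMaxMin_le_of_step hvu (step_add hi) (H_lt_add hi).le))
  · refine lt_of_lt_of_le hu (pathMaxMin_le_of_step ?_ (step_add hi) (H_lt_add hi).le)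
    rintro rfl
    exact not_canAct_fullState hC hH l i hi

lemma H_le_Hcoef {l : Fin K} {u : ActState G} {i : V} (hu : u ∈ bottleneckSet C lam w S k l)
    (hi : i ∈ u.1) (hd : del u i ∉ bottleneckSet C lam w S k l) :
    H C u ≤ Hcoef C lam w S k l :=
  le_csSup (Set.toFinite _).bddAbove ⟨u, ⟨hu, _, hd, step_del hi⟩, rfl⟩

lemma Hcoef_nonneg (l : Fin K) : 0 ≤ Hcoef C lam w S k l := by
  refine Real.sSup_nonneg ?_
  rintro _ ⟨u, -, rfl⟩
  exact H_nonneg C u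

/-- The flow through the boundary of a bottleneck set is small. -/
lemma outflow_bottleneckSet_le (hC : Function.Surjective C) (hH : JointActivityInefficient C)
    (hw : ∀ i, 0 ≤ w i) (l : Fin K) {π : ActState G → ℝ} {r : ℝ} (hr : 0 < r) (hr1 : r ≤ 1)
    (hπ : ∀ u, π u ≤ r ^ ((maxSize C : ℝ) * (1 - H C u))) :
    outflow π (bottleneckSet C lam w S k l)
      ≤ 2 ^ Fintype.card V * (maxSize C * Hcoef C lam w S k l)
        * r ^ ((maxSize C : ℝ) * (1 - Hcoef C lam w S k l)) := by
  set B := bottleneckSet C lam w S k l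
  set h := Hcoef C lam w S k l
  set c := r ^ ((maxSize C : ℝ) * (1 - h))
  have hc : 0 ≤ c := (Real.rpow_pos_of_pos hr _).le
  have h0 : 0 ≤ h := Hcoef_nonneg l
  -- A state contributes only if it lies in the boundary, and then through at most `|u| ≤ M H(u)`
  -- de-activations.
  have hterm : ∀ u : ActState G,
      (∑ i, if i ∈ u.1 ∧ ¬(u ∈ B ↔ del u i ∈ B) then π u else 0) ≤ maxSize C * h * c := by
    intro u
    by_cases hex : ∃ i ∈ u.1, ¬(u ∈ B ↔ del u i ∈ B)
    · obtain ⟨i, hi, hne⟩ := hex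
      have huB : u ∈ B ∧ del u i ∉ B := by
        by_cases hd : del u i ∈ B
        · have := add_mem_bottleneckSet hC hH hw hd (canAct_del hi)
          rw [add_del hi] at this
          exact absurd (iff_of_true this hd) hne
        · refine ⟨?_, hd⟩
          by_contra hu
          exact hne (iff_of_false hu hd)
      have hu : H C u ≤ h := H_le_Hcoef huB.1 hi huB.2
      have hπc : π u ≤ c := (hπ u).trans (Real.rpow_le_rpow_of_exponent_ge hr hr1
        (mul_le_mul_of_nonneg_left (by linarith) (Nat.cast_nonneg _)))
      calc (∑ i, if i ∈ u.1 ∧ ¬(u ∈ B ↔ del u i ∈ B) then π u else 0)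
          ≤ ∑ i, if i ∈ u.1 then c else 0 := by
            refine Finset.sum_le_sum fun i _ => ?_
            by_cases hi : i ∈ u.1 <;> by_cases hb : (u ∈ B ↔ del u i ∈ B) <;> simp [hi, hb, hc, hπc]
        _ = u.1.card * c := by simp
        _ ≤ maxSize C * h * c := by
            refine mul_le_mul_of_nonneg_right ((card_le_maxSize_mul_H C u).trans ?_) hc
            exact mul_le_mul_of_nonneg_left hu (Nat.cast_nonneg _)
    · push Not at hex
      rw [Finset.sum_eq_zero fun i _ => if_neg fun hi => hi.2 (hex i hi.1)]
      positivity
  have hcard : (Fintype.card (ActState G) : ℝ) ≤ 2 ^ Fintype.card V := by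
    have := Fintype.card_subtype_le fun u : Finset V => G.IsIndepSet (u : Set V)
    rw [Fintype.card_finset] at this
    exact_mod_cast this
  rw [outflow, Finset.sum_comm]
  refine (Finset.sum_le_sum fun u _ => hterm u).trans ?_
  rw [Finset.sum_const, nsmul_eq_mul, Finset.card_univ, mul_assoc (2 ^ _)]
  exact mul_le_mul_of_nonneg_right hcard (by positivity)

/-- The flow counts crossing edges once, whichever endpoint lies in the set. -/
lemma outflow_compl (π : ActState G → ℝ) (A : Set (ActState G)) :
    outflow π Aᶜ = outflow π A := by
  simp only [outflow, Set.mem_compl_iff, not_iff_not]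

end Levels

end Bottleneck

/-! ### Two numerical inequalities -/

lemma mul_rpow_le_one {x y : ℝ} (hx : 0 < x) (hx2 : x ≤ 1 / 2) (hy : 0 ≤ y) : y * x ^ y ≤ 1 := by
  have h1 : x ^ y ≤ (2 ^ y)⁻¹ := by
    rw [← Real.inv_rpow two_pos.le, ← one_div]
    exact Real.rpow_le_rpow hx.le hx2 hy
  -- The tangent bound for `exp` gives `e y log 2 ≤ 2 ^ y`, and `e log 2 > 1`.
  have h2 : y ≤ 2 ^ y := by
    have h3 := Real.add_one_le_exp (Real.log 2 * y - 1)
    rw [Real.exp_sub, ← Real.rpow_def_of_pos two_pos, le_div_iff₀ (Real.exp_pos 1)] at h3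
    nlinarith [Real.exp_one_gt_d9, Real.log_two_gt_d9, mul_nonneg hy
      (mul_nonneg (sub_nonneg.2 Real.exp_one_gt_d9.le) (sub_nonneg.2 Real.log_two_gt_d9.le))]
  calc y * x ^ y ≤ 2 ^ y * (2 ^ y)⁻¹ := mul_le_mul h2 h1 (Real.rpow_pos_of_pos hx _).le
        (hy.trans h2)
    _ = 1 := mul_inv_cancel₀ (Real.rpow_pos_of_pos two_pos _).ne'

/-- Here `a` is the mass of the trap, `b = ρ_min`, `c = ρ̂_k`, and `P` is the mass outside `Ω*`. The
third power of `b` arises by using `b ≤ 1 / 2` to absorb the factor `1 / 2`. -/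
lemma light_mass_bound {a b c P γ : ℝ} (hb : 0 < b) (hb2 : b ≤ 1 / 2) (hγ : 0 < γ)
    (hγ4 : γ < 1 / 4) (hbc : b ≤ c) (hP : P ≤ γ * b ^ 2) (ha : b - γ * b ^ 2 ≤ a) :
    c * (1 - 4 * γ) * b ^ 3 < a * (c * a / 2 - P) := by
  have hc : 0 < c := hb.trans_le hbc
  have h1 : b * (1 - γ / 2) ≤ a := by nlinarith [mul_pos hγ hb]
  have h2 : 0 < b * (1 - γ / 2) := mul_pos hb (by linarith)
  have h3 : P ≤ c * (γ * b) := by nlinarith [mul_pos hγ hb]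
  have h4 : c * (a * (a / 2 - γ * b)) ≤ a * (c * a / 2 - P) := by nlinarith
  have h5 : b * (1 - γ / 2) * (b * (1 - γ / 2) / 2 - γ * b) ≤ a * (a / 2 - γ * b) := by
    refine mul_le_mul h1 (by linarith) ?_ (h2.le.trans h1)
    nlinarith
  have h6 : (1 - 4 * γ) * b ^ 3 < b * (1 - γ / 2) * (b * (1 - γ / 2) / 2 - γ * b) := by
    have h7 : (1 - 4 * γ) * b < (1 - γ / 2) * ((1 - γ / 2) / 2 - γ) := by nlinarith
    have := mul_lt_mul_of_pos_left h7 (pow_pos hb 2)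
    nlinarith
  calc c * (1 - 4 * γ) * b ^ 3 = c * ((1 - 4 * γ) * b ^ 3) := by ring
    _ < c * (a * (a / 2 - γ * b)) := mul_lt_mul_of_pos_left (h6.trans_le h5) hc
    _ ≤ _ := h4

/-! ### Traps built from bottleneck sets -/

section Trap

variable {V : Type*} [Fintype V] {G : SimpleGraph V} {K : ℕ} {C : G.Coloring (Fin K)}
  {lam nu : V → ℝ} {p : PMF (NetState G)} {w : V → ℝ} {S : Finset V} {k : Fin K}

lemma IsStationary.ofReal_arrivalRate_le (hp : IsStationary G lam nu p) (hlam : ∀ i, 0 ≤ lam i)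
    (hnu : ∀ i, 0 ≤ nu i) (hw : ∀ i, 0 ≤ w i) (S : Finset V) :
    ENNReal.ofReal (arrivalRate lam w S) ≤ ∑ i ∈ S, ENNReal.ofReal (w i) * meanQueue p i := by
  rw [arrivalRate, ENNReal.ofReal_sum_of_nonneg fun i _ => mul_nonneg (hw i) (hlam i)]
  refine Finset.sum_le_sum fun i _ => ?_
  rw [ENNReal.ofReal_mul (hw i)]
  exact mul_le_mul_right (hp.ofReal_lam_le_meanQueue hlam hnu i) _

/-- Each bottleneck set, or its complement, is a trap for the activity process that contains a
full state other than that of `S` and is entered by de-activations of nodes of `S` only from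
states outside `Ω*`. -/
lemma exists_trap (hK : 2 ≤ K) (hC : Function.Surjective C) (hH : JointActivityInefficient C)
    (hw : ∀ i, 0 ≤ w i) (hpos : 0 < arrivalRate lam w S) (hlam : ∀ i, lam i ≤ 1)
    (hS : S ⊆ comp C k) (l : Fin K) (hl : Hcoef C lam w S k l < 1) (π : ActState G → ℝ) :
    ∃ A : Set (ActState G), (∃ j, fullState C j ∈ A) ∧
      outflow π A = outflow π (bottleneckSet C lam w S k l) ∧
      ∀ i ∈ S, ∀ u : ActState G, i ∈ u.1 → del u i ∈ A → u ∈ (fullStates C)ᶜ := by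
  have hk : fullState C k ∈ Delta G lam w S := fullState_mem_Delta hw hlam hS
  have hfull : ∀ i ∈ S, ∀ u : ActState G, i ∈ u.1 → u ∈ fullStates C → u = fullState C k := by
    rintro i hi u hu ⟨j, rfl⟩
    rw [← mem_comp.1 hu, mem_comp.1 (hS hi)]
  by_cases hlk : l = k
  -- For `l = k` the trap is the complement. Entering it from `v^(k)` would put `v^(k)`, where `H =
  -- 1`, in the boundary, against `H_k(S) < 1`.
  · subst hlk
    have : Nontrivial (Fin K) := Fin.nontrivial_iff_two_le.2 hK
    obtain ⟨j, hj⟩ := exists_ne l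
    refine ⟨_, ⟨j, fullState_notMem_bottleneckSet_own hj⟩, outflow_compl _ _, ?_⟩
    intro i hi u hu hd hmem
    obtain rfl := hfull i hi u hu hmem
    have := H_le_Hcoef (fullState_mem_bottleneckSet hH hpos hS hk l) hu hd
    rw [H_fullState hC] at this
    exact absurd hl (not_lt.2 this)
  -- For `l ≠ k` the set itself is the trap: entering it from `v^(k)` would, by closure under
  -- activation, place `v^(k)` in it.
  · refine ⟨_, ⟨l, fullState_mem_bottleneckSet hH hpos hS hk l⟩, rfl, ?_⟩
    intro i hi u hu hd hmem
    have hu' := add_mem_bottleneckSet hC hH hw hd (canAct_del hu)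
    rw [add_del hu, hfull i hi u hu hmem] at hu'
    exact fullState_notMem_bottleneckSet hk hlk hu'

end Trap

end

end RandomAccess

/-! ### Proof of the theorem -/

open RandomAccess in
theorem theorem4 {V : Type*} [Fintype V] (G : SimpleGraph V) {K : ℕ} (hK : 2 ≤ K)
    (C : G.Coloring (Fin K)) (hC : Function.Surjective C)
    (hclique : ∀ i : V, ∃ Q : Finset V, i ∈ Q ∧ G.IsNClique K Q)
    (hassum : RandomAccess.JointActivityInefficient C)
    (rhoHat : Fin K → ℝ) (hrho : ∀ k, 0 < rhoHat k)
    (lam : V → ℝ) (hlam : ∀ i, lam i = rhoHat (C i))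
    (rho rhoMin : ℝ) (hrho_sum : rho = ∑ k, rhoHat k) (hrho_min : rhoMin = ⨅ k, rhoHat k)
    (gamma : ℝ) (hgamma : 0 < gamma)
    (hload : 1 - gamma * RandomAccess.zeta C * rhoMin ^ 2 ≤ rho)
    (nu : V → ℝ) (hnu_pos : ∀ i, 0 < nu i) (hnu : ∀ i j, C i = C j → nu i = nu j)
    (hstable : RandomAccess.Stable G lam nu)
    (p : PMF (RandomAccess.NetState G)) (hp : RandomAccess.IsStationary G lam nu p)
    (w : V → ℝ) (hw : ∀ i, 0 ≤ w i)
    (k : Fin K) (S : Finset V) (hS : S ⊆ RandomAccess.comp C k) (hwS : ∃ i ∈ S, 0 < w i) :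
    ENNReal.ofReal
        (RandomAccess.drift G lam w S * (1 - 4 * gamma) * rhoMin ^ (RandomAccess.maxSize C + 3)
            / 2 ^ (Fintype.card V + 1)
          * (1 / (1 - rho)) ^
              ((RandomAccess.maxSize C : ℝ) * (1 - RandomAccess.Hstar C lam w S k)))
      < ∑ i ∈ S, ENNReal.ofReal (w i) * RandomAccess.meanQueue p i := by
  have : Nonempty (Fin K) := ⟨k⟩
  have hlam_pos : ∀ i, 0 < lam i := fun i => hlam i ▸ hrho _
  have hlam0 : ∀ i, 0 ≤ lam i := fun i => (hlam_pos i).le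
  have hnu0 : ∀ i, 0 ≤ nu i := fun i => (hnu_pos i).le
  have hrho1 : rho < 1 := hrho_sum ▸ hp.load_lt_one hlam0 hnu_pos hC hassum hlam
  have hmin : ∀ k, rhoMin ≤ rhoHat k := fun k =>
    hrho_min ▸ ciInf_le (Set.finite_range _).bddBelow k
  have hmin0 : 0 < rhoMin := by
    obtain ⟨j, hj⟩ := exists_eq_ciInf_of_finite (f := rhoHat)
    rw [hrho_min, ← hj]
    exact hrho j
  have hmin2 : rhoMin ≤ 1 / 2 := by
    have h1 : K * rhoMin ≤ rho := by
      rw [hrho_sum]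
      simpa using Finset.card_nsmul_le_sum Finset.univ rhoHat rhoMin fun k _ => hmin k
    have h2 : (2 : ℝ) ≤ K := by exact_mod_cast hK
    nlinarith
  have hlam1 : ∀ i, lam i ≤ 1 := fun i => by
    rw [hlam]
    refine le_trans ?_ hrho1.le
    rw [hrho_sum]
    exact Finset.single_le_sum (fun j _ => (hrho j).le) (Finset.mem_univ _)
  have harr : 0 < arrivalRate lam w S := arrivalRate_pos hw hlam_pos hwS
  have hdrift0 : 0 ≤ drift G lam w S := drift_nonneg harr
  have hdrift : drift G lam w S ≤ arrivalRate lam w S := drift_le_arrivalRate hw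
  have hbase : 1 ≤ 1 / (1 - rho) := by
    rw [one_le_div (by linarith), hrho_sum]
    linarith [Finset.sum_nonneg fun k (_ : k ∈ Finset.univ) => (hrho k).le]
  have htriv : ∀ a : ℝ, a < arrivalRate lam w S →
      ENNReal.ofReal a < ∑ i ∈ S, ENNReal.ofReal (w i) * meanQueue p i := fun a ha =>
    ((ENNReal.ofReal_lt_ofReal_iff harr).2 ha).trans_le
      (hp.ofReal_arrivalRate_le hlam0 hnu0 hw S)
  set M := maxSize C
  set N := Fintype.card V
  -- For `γ ≥ 1 / 4` the bound is nonpositive, while the weighted mean backlog is at least the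
  -- positive arrival rate.
  rcases le_or_gt (1 / 4) gamma with hg | hg
  · refine htriv _ (lt_of_le_of_lt ?_ harr)
    refine mul_nonpos_of_nonpos_of_nonneg (div_nonpos_of_nonpos_of_nonneg ?_ (by positivity))
      (Real.rpow_nonneg (by linarith) _)
    exact mul_nonpos_of_nonpos_of_nonneg
      (mul_nonpos_of_nonneg_of_nonpos hdrift0 (by linarith)) (by positivity)
  obtain ⟨l, hl⟩ := exists_eq_ciInf_of_finite (f := Hcoef C lam w S k)
  have hstar : Hstar C lam w S k = Hcoef C lam w S k l := hl.symm
  rw [hstar]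
  set h := Hcoef C lam w S k l
  have h0 : 0 ≤ h := Hcoef_nonneg l
  -- For `h ≥ 1` the power of `1 / (1 - ρ)` is at most one, and the arrival-rate bound suffices.
  rcases le_or_gt 1 h with h1 | h1
  · refine htriv _ ?_
    have e1 : (1 / (1 - rho)) ^ ((M : ℝ) * (1 - h)) ≤ 1 :=
      Real.rpow_le_one_of_one_le_of_nonpos hbase
        (mul_nonpos_of_nonneg_of_nonpos (Nat.cast_nonneg _) (by linarith))
    have e2 : rhoMin ^ (M + 3) ≤ 1 := pow_le_one₀ hmin0.le (by linarith)
    have e3 : (2 : ℝ) ≤ 2 ^ (N + 1) := by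
      simpa using pow_le_pow_right₀ (one_le_two (α := ℝ)) (Nat.le_add_left 1 N)
    have e4 : drift G lam w S * (1 - 4 * gamma) * rhoMin ^ (M + 3) ≤ arrivalRate lam w S := by
      calc _ ≤ arrivalRate lam w S * 1 * 1 := by gcongr <;> linarith
        _ = _ := by ring
    calc _ ≤ arrivalRate lam w S / 2 * 1 := by gcongr
      _ < _ := by linarith
  set P := mass (marginal p) (fullStates C)ᶜ
  have hz := zeta_pos hC hassum
  have hP : P ≤ gamma * rhoMin ^ 2 := by
    have := hp.load_le hlam0 hnu0 hC hassum hlam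
    rw [← hrho_sum] at this
    refine le_of_mul_le_mul_left ?_ hz
    nlinarith
  have hr : 0 < (1 - rho) / rhoMin := div_pos (by linarith) hmin0
  have hr1 : (1 - rho) / rhoMin ≤ 1 := by
    rw [div_le_one hmin0]
    have e1 : gamma * zeta C ≤ 1 :=
      mul_le_one₀ (by linarith) hz.le (zeta_le_one hC)
    nlinarith [mul_le_mul_of_nonneg_right e1 (sq_nonneg rhoMin)]
  have hnur : ∀ i, 1 ≤ nu i * ((1 - rho) / rhoMin) := fun i => by
    rw [← mul_div_assoc, one_le_div hmin0, hrho_sum]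
    exact (hlam i ▸ hmin (C i)).trans (hp.lam_le_mul hlam0 hnu_pos hclique hlam i)
  obtain ⟨A, ⟨j, hj⟩, hout, hrare⟩ :=
    exists_trap hK hC hassum hw harr hlam1 hS l h1 (marginal p)
  set a := mass (marginal p) A
  have ha : rhoMin - gamma * rhoMin ^ 2 ≤ a := by
    have e1 := hp.le_marginal_fullState hlam0 hnu0 hC hlam j
    have e2 : marginal p (fullState C j) ≤ a := le_mass (marginal_nonneg p) hj
    linarith [hmin j]
  have ha0 : 0 < a := by
    refine lt_of_lt_of_le ?_ ha
    nlinarith [mul_pos hgamma hmin0]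
  set T := (1 / (1 - rho)) ^ ((M : ℝ) * (1 - h)) with hT
  have hT0 : 0 < T := Real.rpow_pos_of_pos (by linarith) _
  set R := rhoMin ^ M * T with hR
  have hR0 : 0 < R := by positivity
  have hflow : outflow (marginal p) A ≤ 2 ^ N / R := by
    rw [hout, le_div_iff₀ hR0]
    have e1 := outflow_bottleneckSet_le (lam := lam) (S := S) (k := k) hC hassum hw l hr hr1
      (hp.marginal_le_rpow hlam0 hnu_pos hnu hC hassum hr hnur (by omega))
    -- The factor `ρ_min ^ M` in `R` cancels the denominators of `r` and leaves `ρ_min ^ (M h)`,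
    -- which absorbs the count `M h`.
    have e2 : ((1 - rho) / rhoMin) ^ ((M : ℝ) * (1 - h)) * R = rhoMin ^ ((M : ℝ) * h) := by
      rw [hR, hT, Real.div_rpow (by linarith) hmin0.le, Real.div_rpow zero_le_one (by linarith),
        Real.one_rpow]
      have e3 : rhoMin ^ M = rhoMin ^ ((M : ℝ) * h) * rhoMin ^ ((M : ℝ) * (1 - h)) := by
        rw [← Real.rpow_add hmin0, ← Real.rpow_natCast]
        ring_nf
      have e4 : (1 - rho) ^ ((M : ℝ) * (1 - h)) ≠ 0 := (Real.rpow_pos_of_pos (by linarith) _).ne'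
      have e5 : rhoMin ^ ((M : ℝ) * (1 - h)) ≠ 0 := (Real.rpow_pos_of_pos hmin0 _).ne'
      rw [e3]
      field_simp
    have e6 := mul_rpow_le_one hmin0 hmin2 (mul_nonneg (Nat.cast_nonneg M) h0)
    calc outflow (marginal p) (bottleneckSet C lam w S k l) * R
        ≤ 2 ^ N * (M * h) * ((1 - rho) / rhoMin) ^ ((M : ℝ) * (1 - h)) * R :=
          mul_le_mul_of_nonneg_right e1 hR0.le
      _ = 2 ^ N * (M * h * rhoMin ^ ((M : ℝ) * h)) := by rw [mul_assoc, e2]; ring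
      _ ≤ 2 ^ N * 1 := by gcongr
      _ = 2 ^ N := mul_one _
  -- This `α` makes `α a` exactly twice the bound `2 ^ N / R` on the flow.
  have hα : 0 < 2 * 2 ^ N / (R * a) := by positivity
  refine lt_of_lt_of_le ?_ (hp.le_backlog hlam0 hnu_pos hw S hα (A := A) (R := (fullStates C)ᶜ)
    ?_ hrare)
  · have hws : 0 < ∑ i ∈ S, w i := by
      obtain ⟨i, hi, hwi⟩ := hwS
      exact Finset.sum_pos' (fun j _ => hw j) ⟨i, hi, hwi⟩
    have harr_eq : arrivalRate lam w S = rhoHat k * ∑ i ∈ S, w i := by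
      rw [arrivalRate, Finset.mul_sum]
      refine Finset.sum_congr rfl fun i hi => ?_
      rw [hlam, mem_comp.1 (hS hi), mul_comm]
    have hnum := light_mass_bound hmin0 hmin2 hgamma hg (hmin k) hP ha
    have hpos : 0 < (∑ i ∈ S, w i) * R / 2 ^ (N + 1) := by positivity
    have hlt := mul_lt_mul_of_pos_left hnum hpos
    have hE : arrivalRate lam w S * (a / (2 * (2 * 2 ^ N / (R * a))))
        - (∑ i ∈ S, w i) * P / (2 * 2 ^ N / (R * a))
        = (∑ i ∈ S, w i) * R / 2 ^ (N + 1) * (a * (rhoHat k * a / 2 - P)) := by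
      rw [harr_eq, pow_succ]
      field_simp
    have hle : drift G lam w S * (1 - 4 * gamma) * rhoMin ^ (M + 3) / 2 ^ (N + 1) * T
        ≤ (∑ i ∈ S, w i) * R / 2 ^ (N + 1) * (rhoHat k * (1 - 4 * gamma) * rhoMin ^ 3) := by
      calc _ ≤ arrivalRate lam w S * (1 - 4 * gamma) * rhoMin ^ (M + 3) / 2 ^ (N + 1) * T := by
            gcongr
            linarith
        _ = _ := by
            rw [harr_eq, hR, pow_add]
            ring
    have hlow : 0 ≤ (∑ i ∈ S, w i) * R / 2 ^ (N + 1)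
        * (rhoHat k * (1 - 4 * gamma) * rhoMin ^ 3) := by
      have := hrho k
      have : 0 ≤ 1 - 4 * gamma := by linarith
      positivity
    rw [hE, ENNReal.ofReal_lt_ofReal_iff (hlow.trans_lt hlt)]
    exact hle.trans_lt hlt
  · have : 2 * 2 ^ N / (R * a) * a = 2 * (2 ^ N / R) := by
      field_simp
    rw [this]
    linarith
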